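/- Let $(M,J)$ be a connected complex manifold of real dimension $n\ge 4$, let $g$ be a Kähler metric on $M$, and let $f,\theta:M\to\mathbb R$ be smooth functions with $\theta$ nowhere zero. Suppose that $\hat g:=g/\theta^2$ is a gradient Ricci almost soliton with soliton function $f$, i.e. $\mathrm{Ric}(\hat g)+\hat\nabla df=\hat c\,\hat g$ for some smooth function $\hat c:M\to\mathbb R$, where $\hat\nabla df$ is the $\hat g$-Hessian of $f$. Suppose further that $f$ is a Killing potential for $g$, i.e. $J\nabla f$ is a Killing vector field of $g$, where $\nabla f$ is the $g$-gradient of $f$, and that $\theta$ is locally a function of $f$ with $\theta(0)=1$ and $\theta'(0)=-\frac{2}{n-2}$, in the following sense: - every point $p\in M$ with $df_p\ne 0$ has a neighbourhood on which $\theta=H\circ f$ for some smooth $H:\mathbb R\to\mathbb R$; - $\theta=1$ at every point where $f=0$; - there is a point $p\in M$ with $f(p)=0$ such that, near $p$, $\theta=H\circ f$ for some smooth $H:\mathbb R\to\mathbb R$ with $H(0)=1$ and $H'(0)=-\frac{2}{n-2}$. Then $\theta=e^{-2f/(n-2)}$ on $M$, and $g$ is a gradient Kähler–Ricci soliton: $g$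 is Kähler and there are a smooth function $F:M\to\mathbb R$ and a constant $c\in\mathbb R$ with $\mathrm{Ric}(g)+\nabla dF=c\,g$. -/

import Mathlib

set_option maxSynthPendingDepth 3

open scoped Manifold ContDiff Topology

/-- A complex manifold is, in the same charts, a real smooth manifold. -/
instance complexManifold_isManifold_real {E : Type*} [NormedAddCommGroup E] [NormedSpace ℂ E]
    {M : Type*} [TopologicalSpace M] [ChartedSpace E M] [IsManifold 𝓘(ℂ, E) ∞ M] :
    IsManifold 𝓘(ℝ, E) ∞ M := by
  apply isManifold_of_contDiffOn
  intro e e' he he'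
  have h := (contDiffGroupoid ∞ 𝓘(ℂ, E)).compatible he he'
  rw [contDiffGroupoid, mem_groupoid_of_pregroupoid] at h
  exact h.1.restrict_scalars ℝ

noncomputable section

/-! ### Riemannian geometry of a metric field on (an open set of) a real vector space

`G y` is the metric at the point `y`; vectors stand for constant vector fields. -/

namespace LocalMetric

variable {E : Type*} [NormedAddCommGroup E] [NormedSpace ℝ E]

/-- Christoffel symbols of the first kind:
`christoffelLower G y u v w = ½ (∂_u G(v, w) + ∂_v G(u, w) - ∂_w G(u, v))` at `y`. -/
def christoffelLower (G : E → E →L[ℝ] E →L[ℝ] ℝ) (y : E) : E →L[ℝ] E →L[ℝ] E →L[ℝ] ℝ :=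
  (1 / 2 : ℝ) • (fderiv ℝ G y + (fderiv ℝ G y).flip
    - (ContinuousLinearMap.flipₗᵢ ℝ E E ℝ).toContinuousLinearEquiv.toContinuousLinearMap ∘L
        (fderiv ℝ G y).flip)

theorem christoffelLower_apply (G : E → E →L[ℝ] E →L[ℝ] ℝ) (y u v w : E) :
    christoffelLower G y u v w =
      (1 / 2 : ℝ) * (fderiv ℝ G y u v w + fderiv ℝ G y v u w - fderiv ℝ G y w u v) := rfl

/-- The Levi-Civita connection of `G`: `christoffel G y u v = ∇_u v` for constant fields `u`, `v`,
i.e. `G y (christoffel G y u v) w = christoffelLower G y u v w`. -/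
def christoffel (G : E → E →L[ℝ] E →L[ℝ] ℝ) (y : E) : E →L[ℝ] E →L[ℝ] E :=
  (ContinuousLinearMap.compL ℝ E (E →L[ℝ] ℝ) E (G y).inverse) ∘L christoffelLower G y

theorem christoffel_apply (G : E → E →L[ℝ] E →L[ℝ] ℝ) (y u v : E) :
    christoffel G y u v = (G y).inverse (christoffelLower G y u v) := rfl

/-- The Riemann curvature tensor `u ↦ R(u, v) w`, where
`R(u, v) w = ∇_u ∇_v w - ∇_v ∇_u w` for constant fields. -/
def curvature (G : E → E →L[ℝ] E →L[ℝ] ℝ) (y v w : E) : E →L[ℝ] E :=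
  ((fderiv ℝ (christoffel G) y).flip v).flip w
    - (fderiv ℝ (christoffel G) y v).flip w
    + (christoffel G y).flip (christoffel G y v w)
    - (christoffel G y v) ∘L ((christoffel G y).flip w)

theorem curvature_apply (G : E → E →L[ℝ] E →L[ℝ] ℝ) (y u v w : E) :
    curvature G y v w u =
      fderiv ℝ (christoffel G) y u v w - fderiv ℝ (christoffel G) y v u w
        + christoffel G y u (christoffel G y v w) - christoffel G y v (christoffel G y u w) := rfl

/-- The Ricci tensor: `Ric(v, w)` is the trace of `u ↦ R(u, v) w`. -/
def ricci (G : E → E →L[ℝ] E →L[ℝ] ℝ) (y v w : E) : ℝ :=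
  LinearMap.trace ℝ E (curvature G y v w : E →ₗ[ℝ] E)

/-- The Hessian `∇dF` of a function. -/
def hessian (G : E → E →L[ℝ] E →L[ℝ] ℝ) (F : E → ℝ) (y u v : E) : ℝ :=
  fderiv ℝ (fderiv ℝ F) y u v - fderiv ℝ F y (christoffel G y u v)

/-- The gradient: `G y (gradient G F y) w = dF_y(w)`. -/
def gradient (G : E → E →L[ℝ] E →L[ℝ] ℝ) (F : E → ℝ) (y : E) : E :=
  (G y).inverse (fderiv ℝ F y)

/-- The Lie derivative `(L_X G)(v, w)` of the metric along the vector field `X`. -/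
def lieDerivative (G : E → E →L[ℝ] E →L[ℝ] ℝ) (X : E → E) (y v w : E) : ℝ :=
  fderiv ℝ G y (X y) v w + G y (fderiv ℝ X y v) w + G y v (fderiv ℝ X y w)

end LocalMetric

/-! ### Metrics on a complex manifold `M` modelled on the complex vector space `E`

Tensor equations on `M` are expressed in every (holomorphic) chart of the atlas. In such a chart
the complex structure `J` of `M` is multiplication by `i`. -/

section Manifold

variable {E : Type*} [NormedAddCommGroup E] [NormedSpace ℂ E]
  {M : Type*} [TopologicalSpace M] [ChartedSpace E M] [IsManifold 𝓘(ℂ, E) ∞ M]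

variable (E M) in
/-- Smooth Riemannian metrics on the real manifold underlying `M`. -/
abbrev SmoothRiemannianMetric : Type _ :=
  Bundle.ContMDiffRiemannianMetric 𝓘(ℝ, E) ∞ E (fun x : M => TangentSpace 𝓘(ℝ, E) x)

namespace SmoothRiemannianMetric

/-- The expression of `g` in the chart `φ`: the pull-back of `g` under `φ⁻¹`. -/
def inChart (g : SmoothRiemannianMetric E M) (φ : OpenPartialHomeomorph M E) (y : E) :
    E →L[ℝ] E →L[ℝ] ℝ :=
  let A : E →L[ℝ] E := mfderiv 𝓘(ℝ, E) 𝓘(ℝ, E) φ.symm y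
  let B : E →L[ℝ] E →L[ℝ] ℝ := g.inner (φ.symm y)
  B.bilinearComp A A

theorem inChart_apply (g : SmoothRiemannianMetric E M) (φ : OpenPartialHomeomorph M E)
    (y u v : E) :
    g.inChart φ y u v =
      g.inner (φ.symm y) (mfderiv 𝓘(ℝ, E) 𝓘(ℝ, E) φ.symm y u)
        (mfderiv 𝓘(ℝ, E) 𝓘(ℝ, E) φ.symm y v) := rfl

/-- `g` is a Kähler metric on the complex manifold `M`: it is hermitian, and its Kähler form
`ω(u, v) = g(Ju, v)` is closed. -/
def IsKahler (g : SmoothRiemannianMetric E M) : Prop :=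
  ∀ φ ∈ atlas E M, ∀ y ∈ φ.target,
    (∀ u v : E, g.inChart φ y (Complex.I • u) (Complex.I • v) = g.inChart φ y u v) ∧
    (∀ u v w : E,
      fderiv ℝ (fun z => g.inChart φ z (Complex.I • v) w) y u
        + fderiv ℝ (fun z => g.inChart φ z (Complex.I • w) u) y v
        + fderiv ℝ (fun z => g.inChart φ z (Complex.I • u) v) y w = 0)

/-- `f` is a Killing potential: `f` is smooth and `J∇f` is a Killing vector field. -/
def IsKillingPotential (g : SmoothRiemannianMetric E M) (f : M → ℝ) : Prop :=
  ContMDiff 𝓘(ℝ, E) 𝓘(ℝ, ℝ) ∞ f ∧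
  ∀ φ ∈ atlas E M, ∀ y ∈ φ.target, ∀ v w : E,
    LocalMetric.lieDerivative (g.inChart φ)
      (fun z => Complex.I • LocalMetric.gradient (g.inChart φ) (f ∘ φ.symm) z) y v w = 0

/-- The equation `Ric(g) + ∇df = c g` on `M`. -/
def RicciHessianEquation (g : SmoothRiemannianMetric E M) (f c : M → ℝ) : Prop :=
  ∀ φ ∈ atlas E M, ∀ y ∈ φ.target, ∀ v w : E,
    LocalMetric.ricci (g.inChart φ) y v w
        + LocalMetric.hessian (g.inChart φ) (f ∘ φ.symm) y v w
      = c (φ.symm y) * g.inChart φ y v w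

/-- `g` is a gradient Ricci almost soliton with soliton function `f`. -/
def IsGradientRicciAlmostSoliton (g : SmoothRiemannianMetric E M) (f : M → ℝ) : Prop :=
  ContMDiff 𝓘(ℝ, E) 𝓘(ℝ, ℝ) ∞ f ∧
  ∃ c : M → ℝ, ContMDiff 𝓘(ℝ, E) 𝓘(ℝ, ℝ) ∞ c ∧ g.RicciHessianEquation f c

/-- `g` is a gradient Ricci soliton with soliton function `f`: the metric coefficient is
constant. -/
def IsGradientRicciSoliton (g : SmoothRiemannianMetric E M) (f : M → ℝ) : Prop :=
  ContMDiff 𝓘(ℝ, E) 𝓘(ℝ, ℝ) ∞ f ∧ ∃ c : ℝ, g.RicciHessianEquation f (fun _ => c)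

/-- `g` is a gradient Kähler–Ricci soliton: a Kähler metric which is a gradient Ricci soliton for
some soliton function. -/
def IsGradientKahlerRicciSoliton (g : SmoothRiemannianMetric E M) : Prop :=
  g.IsKahler ∧ ∃ F : M → ℝ, g.IsGradientRicciSoliton F

end SmoothRiemannianMetric

end Manifold

end

/-! Write $m=n-2$ and $\sigma=\log|\theta|$. The conformal change formulas
(`IsMetricOn.ricci_conformal`, `IsMetricOn.hessian_conformal`) turn the almost soliton equation for
$\hat g=e^{-2\sigma}g$ into: $\mathrm{Ric}(g)+\nabla df+\theta^{-1}(m\nabla d\theta+d\theta\otimes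
df+df\otimes d\theta)$ is a multiple of $g$. The Ricci tensor of a Kähler metric is hermitian
(`IsKahlerOn.ricci_I_I`), and so is the Hessian of a Killing potential (`IsKahlerOn.hessian_I_I`).
Hence the bracket is hermitian, which is a linear condition on $\theta$.

The function $W\circ f$ with $W(t)=e^{-2t/m}$ satisfies the same condition, because $mW''+2W'=0$. In
a holomorphic chart the difference $w=\theta-W\circ f$ therefore solves
$D^2w(u,v)-D^2w(iu,iv)=dw(P(u,v))$. This overdetermined system closes after one differentiation: all
third derivatives are linear in the first and second ones. By Grönwall along segments, $w$ is
determined by its 2-jet at one point (`eq_zero_of_jet_eq_zero`). Near the given zero of $f$, $w$ is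
a function of $f$ vanishing to second order. Its 2-jet there is zero because a nonzero $df\otimes
df$ is never hermitian (`jet_eq_zero_of_eventuallyEq_comp`). Connectedness then gives $w=0$ on all
of $M$.

With $\theta=e^{-2f/m}$ the $df\otimes df$ terms cancel and $\mathrm{Ric}(g)-\nabla df=\gamma g$.
The 2-forms obtained from $\mathrm{Ric}(g)$ and $\nabla df$ by inserting $J$ are closed, so
$d(\gamma\omega)=0$, that is $d\gamma\wedge\omega=0$. This forces $d\gamma=0$ in real dimension
above 2 (`IsKahlerOn.hasFDerivAt_zero_of_ricci_sub_hessian`). The soliton function is $F=-f$. -/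

noncomputable section

namespace LocalMetric

/-! ### Derivatives of operator-valued maps -/

section Calculus

variable {E F F' F'' : Type*} [NormedAddCommGroup E] [NormedSpace ℝ E]
  [NormedAddCommGroup F] [NormedSpace ℝ F] [NormedAddCommGroup F'] [NormedSpace ℝ F']
  [NormedAddCommGroup F''] [NormedSpace ℝ F'']

theorem hasFDerivAt_apply {A : E → F →L[ℝ] F'} {y : E} (hA : DifferentiableAt ℝ A y) (v : F) :
    HasFDerivAt (fun z => A z v) ((fderiv ℝ A y).flip v) y := by
  simpa using hA.hasFDerivAt.clm_apply (hasFDerivAt_const v y)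

theorem fderiv_apply {A : E → F →L[ℝ] F'} {y : E} (hA : DifferentiableAt ℝ A y) (v : F) (u : E) :
    fderiv ℝ (fun z => A z v) y u = fderiv ℝ A y u v := by
  rw [(hasFDerivAt_apply hA v).fderiv]; rfl

theorem fderiv_apply₂ {A : E → F →L[ℝ] F' →L[ℝ] F''} {y : E} (hA : DifferentiableAt ℝ A y)
    (v : F) (w : F') (u : E) :
    fderiv ℝ (fun z => A z v w) y u = fderiv ℝ A y u v w := by
  rw [fderiv_apply (hasFDerivAt_apply hA v).differentiableAt, fderiv_apply hA]

theorem fderiv_clm_apply' {A : E → F →L[ℝ] F'} {c : E → F} {y : E} (hA : DifferentiableAt ℝ A y)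
    (hc : DifferentiableAt ℝ c y) (u : E) :
    fderiv ℝ (fun z => A z (c z)) y u = fderiv ℝ A y u (c y) + A y (fderiv ℝ c y u) := by
  rw [(hA.hasFDerivAt.clm_apply hc.hasFDerivAt).fderiv]
  simp [add_comm]

theorem fderiv_fderiv_comm {f : E → F} {y : E} (hf : ContDiffAt ℝ ∞ f y) (u v : E) :
    fderiv ℝ (fderiv ℝ f) y u v = fderiv ℝ (fderiv ℝ f) y v u :=
  (hf.isSymmSndFDerivAt (by simpa using ENat.LEInfty.out)) u v

end Calculus

/-! ### The Levi-Civita connection and the symmetries of its curvature -/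

variable {E : Type*} [NormedAddCommGroup E] [NormedSpace ℝ E]

theorem curvature_antisymm (G : E → E →L[ℝ] E →L[ℝ] ℝ) (y u v w : E) :
    curvature G y v w u = -curvature G y u w v := by
  simp only [curvature_apply]
  abel

/-- `G` is a smooth Riemannian metric on the open set `U`. -/
structure IsMetricOn (G : E → E →L[ℝ] E →L[ℝ] ℝ) (U : Set E) : Prop where
  isOpen : IsOpen U
  contDiffOn : ContDiffOn ℝ ∞ G U
  symm : ∀ y ∈ U, ∀ u v, G y u v = G y v u
  pos : ∀ y ∈ U, ∀ v, v ≠ 0 → 0 < G y v v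

namespace IsMetricOn

variable {G : E → E →L[ℝ] E →L[ℝ] ℝ} {U : Set E} {y : E}

theorem contDiffAt (h : IsMetricOn G U) (hy : y ∈ U) : ContDiffAt ℝ ∞ G y :=
  h.contDiffOn.contDiffAt (h.isOpen.mem_nhds hy)

theorem differentiableAt (h : IsMetricOn G U) (hy : y ∈ U) : DifferentiableAt ℝ G y :=
  (h.contDiffAt hy).differentiableAt (by simp)

theorem ext (h : IsMetricOn G U) (hy : y ∈ U) {a b : E} (hab : ∀ w, G y a w = G y b w) :
    a = b := by
  by_contra hne
  have := h.pos y hy (a - b) (sub_ne_zero.2 hne)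
  simp [hab] at this

theorem contDiffOn_fderiv (h : IsMetricOn G U) : ContDiffOn ℝ ∞ (fderiv ℝ G) U :=
  h.contDiffOn.fderiv_of_isOpen h.isOpen (by simp)

theorem contDiffOn_christoffelLower (h : IsMetricOn G U) :
    ContDiffOn ℝ ∞ (christoffelLower G) U := by
  have h1 := h.contDiffOn_fderiv
  have h2 : ContDiffOn ℝ ∞ (fun y => (fderiv ℝ G y).flip) U :=
    (ContinuousLinearMap.flipₗᵢ ℝ E E (E →L[ℝ] ℝ)).toContinuousLinearEquiv.contDiff.comp_contDiffOn
      h1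
  exact ((h1.add h2).sub (contDiffOn_const.clm_comp h2)).const_smul _

theorem fderiv_symm (h : IsMetricOn G U) (hy : y ∈ U) (u v w : E) :
    fderiv ℝ G y u v w = fderiv ℝ G y u w v := by
  have hd := h.differentiableAt hy
  rw [← fderiv_apply₂ hd, ← fderiv_apply₂ hd]
  congr 1
  apply Filter.EventuallyEq.fderiv_eq
  filter_upwards [h.isOpen.mem_nhds hy] with z hz using h.symm z hz v w

variable [FiniteDimensional ℝ E]

theorem exists_equiv (h : IsMetricOn G U) (hy : y ∈ U) :
    ∃ e : E ≃L[ℝ] (E →L[ℝ] ℝ), (e : E →L[ℝ] E →L[ℝ] ℝ) = G y := by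
  have hinj : Function.Injective (G y : E →ₗ[ℝ] (E →L[ℝ] ℝ)) := fun a b hab =>
    h.ext hy fun w => congrArg (fun L : E →L[ℝ] ℝ => L w) hab
  have hfin : Module.finrank ℝ E = Module.finrank ℝ (E →L[ℝ] ℝ) := by
    rw [← (LinearMap.toContinuousLinearMap (𝕜 := ℝ) (E := E) (F' := ℝ)).finrank_eq]
    exact (Subspace.dual_finrank_eq (K := ℝ) (V := E)).symm
  refine ⟨(LinearEquiv.ofInjectiveOfFinrankEq _ hinj hfin).toContinuousLinearEquiv, ?_⟩
  ext a b
  rfl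

theorem apply_inverse (h : IsMetricOn G U) (hy : y ∈ U) (ξ : E →L[ℝ] ℝ) :
    G y ((G y).inverse ξ) = ξ := by
  obtain ⟨e, he⟩ := h.exists_equiv hy
  rw [← he, ContinuousLinearMap.inverse_equiv]
  simp

theorem contDiffOn_inverse (h : IsMetricOn G U) :
    ContDiffOn ℝ ∞ (fun y => (G y).inverse) U := by
  intro y hy
  obtain ⟨e, he⟩ := h.exists_equiv hy
  have := FiniteDimensional.complete ℝ E
  have h1 := contDiffAt_map_inverse (n := ∞) e
  rw [he] at h1
  exact h1.comp_contDiffWithinAt y (h.contDiffOn y hy)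

theorem contDiffOn_christoffel (h : IsMetricOn G U) : ContDiffOn ℝ ∞ (christoffel G) U :=
  ((ContinuousLinearMap.compL ℝ E (E →L[ℝ] ℝ) E).contDiff.comp_contDiffOn
    h.contDiffOn_inverse).clm_comp h.contDiffOn_christoffelLower

theorem differentiableAt_christoffel (h : IsMetricOn G U) (hy : y ∈ U) :
    DifferentiableAt ℝ (christoffel G) y :=
  (h.contDiffOn_christoffel.contDiffAt (h.isOpen.mem_nhds hy)).differentiableAt (by simp)

theorem apply_christoffel (h : IsMetricOn G U) (hy : y ∈ U) (u v w : E) :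
    G y (christoffel G y u v) w =
      (1 / 2 : ℝ) * (fderiv ℝ G y u v w + fderiv ℝ G y v u w - fderiv ℝ G y w u v) := by
  rw [christoffel_apply, h.apply_inverse hy, christoffelLower_apply]

theorem christoffel_symm (h : IsMetricOn G U) (hy : y ∈ U) (u v : E) :
    christoffel G y u v = christoffel G y v u := by
  refine h.ext hy fun w => ?_
  rw [h.apply_christoffel hy, h.apply_christoffel hy, h.fderiv_symm hy w u v]
  ring

/-- The Levi-Civita connection is metric. -/
theorem fderiv_eq (h : IsMetricOn G U) (hy : y ∈ U) (u v w : E) :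
    fderiv ℝ G y u v w = G y (christoffel G y u v) w + G y v (christoffel G y u w) := by
  rw [h.symm y hy v, h.apply_christoffel hy, h.apply_christoffel hy, h.fderiv_symm hy w u v,
    h.fderiv_symm hy v u w, h.fderiv_symm hy u w v]
  ring

theorem fderiv_christoffel_symm (h : IsMetricOn G U) (hy : y ∈ U) (a u v : E) :
    fderiv ℝ (christoffel G) y a u v = fderiv ℝ (christoffel G) y a v u := by
  have hd := h.differentiableAt_christoffel hy
  rw [← fderiv_apply₂ hd, ← fderiv_apply₂ hd]
  congr 1
  apply Filter.EventuallyEq.fderiv_eq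
  filter_upwards [h.isOpen.mem_nhds hy] with z hz using h.christoffel_symm hz u v

/-- The second derivatives of the metric in terms of the connection. -/
theorem fderiv_fderiv_eq (h : IsMetricOn G U) (hy : y ∈ U) (a u v w : E) :
    fderiv ℝ (fderiv ℝ G) y a u v w =
      fderiv ℝ G y a (christoffel G y u v) w + G y (fderiv ℝ (christoffel G) y a u v) w +
        (fderiv ℝ G y a v (christoffel G y u w) + G y v (fderiv ℝ (christoffel G) y a u w)) := by
  have hG := h.differentiableAt hy
  have hΓ := h.differentiableAt_christoffel hy
  have hΓ' (p q : E) : DifferentiableAt ℝ (fun z => christoffel G z p q) y :=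
    (hasFDerivAt_apply (hasFDerivAt_apply hΓ p).differentiableAt q).differentiableAt
  have hDG : DifferentiableAt ℝ (fderiv ℝ G) y :=
    (h.contDiffOn_fderiv.contDiffAt (h.isOpen.mem_nhds hy)).differentiableAt (by simp)
  have e1 : fderiv ℝ (fderiv ℝ G) y a u v w = fderiv ℝ (fun z => fderiv ℝ G z u v w) y a := by
    rw [fderiv_apply (hasFDerivAt_apply (hasFDerivAt_apply hDG u).differentiableAt
      v).differentiableAt, fderiv_apply (hasFDerivAt_apply hDG u).differentiableAt,
      fderiv_apply hDG]
  have e2 : (fun z => fderiv ℝ G z u v w) =ᶠ[𝓝 y]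
      fun z => G z (christoffel G z u v) w + G z v (christoffel G z u w) := by
    filter_upwards [h.isOpen.mem_nhds hy] with z hz using h.fderiv_eq hz u v w
  have d1 : DifferentiableAt ℝ (fun z => G z (christoffel G z u v)) y :=
    hG.clm_apply (hΓ' u v)
  have d2 : DifferentiableAt ℝ (fun z => G z v) y := (hasFDerivAt_apply hG v).differentiableAt
  rw [e1, e2.fderiv_eq, fderiv_fun_add (hasFDerivAt_apply d1 w).differentiableAt
    (d2.clm_apply (hΓ' u w)), add_apply, fderiv_apply d1,
    fderiv_clm_apply' hG (hΓ' u v), fderiv_clm_apply' d2 (hΓ' u w), fderiv_apply hG,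
    fderiv_apply₂ hΓ, fderiv_apply₂ hΓ]
  rfl

/-- The curvature operators are skew-symmetric. -/
theorem curvature_skew (h : IsMetricOn G U) (hy : y ∈ U) (u v w x : E) :
    G y (curvature G y v w u) x + G y w (curvature G y v x u) = 0 := by
  -- Skewness is the commutation of $\partial_u$ and $\partial_v$ on the metric coefficient
  -- $G(w,x)$, expanded by metric compatibility.
  have hs : fderiv ℝ (fderiv ℝ G) y u v w x = fderiv ℝ (fderiv ℝ G) y v u w x := by
    rw [fderiv_fderiv_comm (h.contDiffAt hy) u v]
  rw [h.fderiv_fderiv_eq hy, h.fderiv_fderiv_eq hy] at hs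
  simp only [h.fderiv_eq hy] at hs
  simp only [curvature_apply, map_add, map_sub, add_apply,
    sub_apply]
  linarith

/-- The first Bianchi identity. -/
theorem curvature_bianchi (h : IsMetricOn G U) (hy : y ∈ U) (u v w : E) :
    curvature G y v w u + curvature G y w u v + curvature G y u v w = 0 := by
  simp only [curvature_apply]
  rw [h.fderiv_christoffel_symm hy u v w, h.fderiv_christoffel_symm hy v u w,
    h.fderiv_christoffel_symm hy w u v, h.christoffel_symm hy w v, h.christoffel_symm hy w u,
    h.christoffel_symm hy v u]
  abel

/-- The pair symmetry of the curvature tensor. -/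
theorem curvature_pair_symm (h : IsMetricOn G U) (hy : y ∈ U) (u v w x : E) :
    G y (curvature G y v w u) x = G y (curvature G y x u w) v := by
  have sk (a b c d : E) : G y (curvature G y b c a) d = - G y (curvature G y b d a) c := by
    have := h.curvature_skew hy a b c d
    rw [h.symm y hy c] at this
    linarith
  have an (a b c d : E) : G y (curvature G y b c a) d = - G y (curvature G y a c b) d := by
    rw [curvature_antisymm]; simp
  have bi (a b c d : E) : G y (curvature G y b c a) d + G y (curvature G y c a b) d
      + G y (curvature G y a b c) d = 0 := by
    have := congrArg (fun z => G y z d) (h.curvature_bianchi hy a b c)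
    simpa using this
  -- Octahedron argument: the Bianchi identities for the four cyclic shifts of $u,v,w,x$ are
  -- combined linearly and reduced by the two skew-symmetries.
  have b1 := bi u v w x
  have b2 := bi v w x u
  have b3 := bi w x u v
  have b4 := bi x u v w
  have := sk u v w x
  have := sk w x u v
  have := sk v w u x
  have := sk u w v x
  have := sk x u v w
  have := sk x v u w
  have := sk v x w u
  have := sk u x w v
  have := an u v w x
  have := an v w u x
  have := an w u v x
  have := an v w x u
  have := an w x v u
  have := an x v w u
  have := an w x u v
  have := an x u w v
  have := an u w x v
  have := an x u v w
  have := an u v x w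
  have := an v x u w
  have := sk v w x u
  have := sk u v x w
  have := sk w u v x
  have := sk u w x v
  have := sk w x v u
  have := sk x v w u
  linarith

end IsMetricOn

end LocalMetric

/-! ### Kähler metrics in a holomorphic chart: complex linearity, Ricci tensor, Ricci form -/

namespace LocalMetric

variable {E : Type*} [NormedAddCommGroup E] [NormedSpace ℂ E]

variable (E) in
/-- Multiplication by `i`. -/
def complexJ : E →L[ℝ] E := Complex.I • ContinuousLinearMap.id ℝ E

@[simp] theorem complexJ_apply (v : E) : complexJ E v = Complex.I • v := rfl

theorem I_smul_I_smul (v : E) : Complex.I • Complex.I • v = -v := by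
  rw [smul_smul, Complex.I_mul_I, neg_one_smul]

theorem trace_complexJ_conj (A : E →L[ℝ] E) :
    LinearMap.trace ℝ E ((complexJ E ∘L A ∘L complexJ E : E →L[ℝ] E) : E →ₗ[ℝ] E) =
      - LinearMap.trace ℝ E (A : E →ₗ[ℝ] E) := by
  have h1 := LinearMap.trace_mul_comm ℝ (complexJ E : E →ₗ[ℝ] E)
    ((A : E →ₗ[ℝ] E) * (complexJ E : E →ₗ[ℝ] E))
  have h2 : ((A : E →ₗ[ℝ] E) * (complexJ E : E →ₗ[ℝ] E)) * (complexJ E : E →ₗ[ℝ] E)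
      = -(A : E →ₗ[ℝ] E) := by
    ext v
    simp [I_smul_I_smul]
  rw [h2, map_neg] at h1
  exact h1

/-- `G` is a Kähler metric on the open set `U`. -/
structure IsKahlerOn (G : E → E →L[ℝ] E →L[ℝ] ℝ) (U : Set E) : Prop extends IsMetricOn G U where
  herm : ∀ y ∈ U, ∀ u v : E, G y (Complex.I • u) (Complex.I • v) = G y u v
  closed : ∀ y ∈ U, ∀ u v w : E, fderiv ℝ G y u (Complex.I • v) w
    + fderiv ℝ G y v (Complex.I • w) u + fderiv ℝ G y w (Complex.I • u) v = 0

namespace IsKahlerOn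

variable {G : E → E →L[ℝ] E →L[ℝ] ℝ} {U : Set E} {y : E}

theorem apply_I_left (h : IsKahlerOn G U) (hy : y ∈ U) (u v : E) :
    G y (Complex.I • u) v = - G y u (Complex.I • v) := by
  rw [← h.herm y hy u, I_smul_I_smul]
  simp

theorem fderiv_herm (h : IsKahlerOn G U) (hy : y ∈ U) (u v w : E) :
    fderiv ℝ G y u (Complex.I • v) (Complex.I • w) = fderiv ℝ G y u v w := by
  have hd := h.differentiableAt hy
  rw [← fderiv_apply₂ hd, ← fderiv_apply₂ hd]
  congr 1
  apply Filter.EventuallyEq.fderiv_eq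
  filter_upwards [h.isOpen.mem_nhds hy] with z hz using h.herm z hz v w

theorem fderiv_I_left (h : IsKahlerOn G U) (hy : y ∈ U) (a u v : E) :
    fderiv ℝ G y a (Complex.I • u) v = - fderiv ℝ G y a u (Complex.I • v) := by
  rw [← h.fderiv_herm hy a u, I_smul_I_smul]
  simp

variable [FiniteDimensional ℂ E]

/-- The Levi-Civita connection of a Kähler metric is complex linear. -/
theorem christoffel_I_right (h : IsKahlerOn G U) (hy : y ∈ U) (u v : E) :
    christoffel G y u (Complex.I • v) = Complex.I • christoffel G y u v := by
  refine h.ext hy fun w => ?_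
  rw [h.apply_I_left hy, h.apply_christoffel hy, h.apply_christoffel hy]
  -- This is $d\omega=0\Rightarrow\nabla J=0$: the difference of $d\omega(u,v,w)$ and
  -- $d\omega(u,iv,iw)$ gives the claim once the Christoffel symbols are written through derivatives
  -- of $G$.
  have c1 := h.closed y hy u v w
  have c2 := h.closed y hy u (Complex.I • v) (Complex.I • w)
  simp only [I_smul_I_smul, map_neg, neg_apply] at c2
  have e1 := h.fderiv_I_left hy u v w
  have e2 := h.fderiv_I_left hy w u v
  have e3 := h.fderiv_symm hy v (Complex.I • w) u
  have e4 := h.fderiv_symm hy (Complex.I • v) w u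
  have e5 := h.fderiv_herm hy (Complex.I • w) u v
  have e6 := h.fderiv_I_left hy v u w
  linarith

theorem christoffel_I_left (h : IsKahlerOn G U) (hy : y ∈ U) (u v : E) :
    christoffel G y (Complex.I • u) v = Complex.I • christoffel G y u v := by
  rw [h.christoffel_symm hy, h.christoffel_I_right hy, h.christoffel_symm hy]

theorem fderiv_christoffel_I (h : IsKahlerOn G U) (hy : y ∈ U) (a u v : E) :
    fderiv ℝ (christoffel G) y a u (Complex.I • v) =
      Complex.I • fderiv ℝ (christoffel G) y a u v := by
  have hd := h.differentiableAt_christoffel hy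
  have hd' : DifferentiableAt ℝ (fun z => christoffel G z u v) y :=
    (hasFDerivAt_apply (hasFDerivAt_apply hd u).differentiableAt v).differentiableAt
  rw [← fderiv_apply₂ hd, ← fderiv_apply₂ hd]
  have : (fun z => christoffel G z u (Complex.I • v)) =ᶠ[𝓝 y]
      fun z => complexJ E (christoffel G z u v) := by
    filter_upwards [h.isOpen.mem_nhds hy] with z hz using h.christoffel_I_right hz u v
  have hc := (complexJ E).hasFDerivAt.comp y hd'.hasFDerivAt
  rw [this.fderiv_eq]
  exact congrArg (fun L : E →L[ℝ] E => L a) hc.fderiv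

theorem curvature_I (h : IsKahlerOn G U) (hy : y ∈ U) (u v w : E) :
    curvature G y v (Complex.I • w) u = Complex.I • curvature G y v w u := by
  simp only [curvature_apply, h.fderiv_christoffel_I hy, h.christoffel_I_right hy, smul_add,
    smul_sub]

/-- Pair symmetry moves $u,v$ into the slots where the curvature operator acts; that operator
commutes with $J$, and $J$ is an isometry. -/
theorem curvature_I_I (h : IsKahlerOn G U) (hy : y ∈ U) (u v w : E) :
    curvature G y (Complex.I • v) w (Complex.I • u) = curvature G y v w u := by
  refine h.ext hy fun x => ?_
  rw [h.curvature_pair_symm hy, h.curvature_I hy, h.herm y hy, ← h.curvature_pair_symm hy]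

/-- The Ricci tensor of a Kähler metric is hermitian. -/
theorem ricci_I_I (h : IsKahlerOn G U) (hy : y ∈ U) (v w : E) :
    ricci G y (Complex.I • v) (Complex.I • w) = ricci G y v w := by
  -- Since $J^{-1}=-J$, this operator is the conjugate by $J$ of $u\mapsto R(u,v)w$, so the traces
  -- agree.
  have : curvature G y (Complex.I • v) (Complex.I • w) =
      -(complexJ E ∘L curvature G y v w ∘L complexJ E) := by
    ext u
    have h1 := h.curvature_I_I hy (Complex.I • u) v w
    rw [I_smul_I_smul, map_neg] at h1
    rw [h.curvature_I hy]
    simp [← h1]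
  rw [ricci, ricci, this]
  have h2 := trace_complexJ_conj (curvature G y v w)
  simp only [ContinuousLinearMap.toLinearMap_neg, map_neg]
  linarith

variable (E) in
/-- The functional `A ↦ tr (J A)`. -/
def traceJ : (E →L[ℝ] E) →L[ℝ] ℝ :=
  have := FiniteDimensional.complexToReal E
  LinearMap.toContinuousLinearMap
    { toFun := fun A => LinearMap.trace ℝ E ((complexJ E ∘L A : E →L[ℝ] E) : E →ₗ[ℝ] E)
      map_add' := fun A B => by
        rw [← map_add]; congr 1; ext; simp
      map_smul' := fun r A => by
        rw [RingHom.id_apply, ← map_smul]; congr 1; ext v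
        exact (smul_comm Complex.I r (A v) : _) }

theorem traceJ_apply (A : E →L[ℝ] E) :
    traceJ E A = LinearMap.trace ℝ E ((complexJ E ∘L A : E →L[ℝ] E) : E →ₗ[ℝ] E) := rfl

theorem traceJ_comp_comm {A B : E →L[ℝ] E} (hA : ∀ v, A (Complex.I • v) = Complex.I • A v) :
    traceJ E (A ∘L B) = traceJ E (B ∘L A) := by
  rw [traceJ_apply, traceJ_apply]
  have h1 := LinearMap.trace_mul_comm ℝ (A : E →ₗ[ℝ] E)
    ((complexJ E : E →ₗ[ℝ] E) * (B : E →ₗ[ℝ] E))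
  have h2 : ((complexJ E ∘L (A ∘L B) : E →L[ℝ] E) : E →ₗ[ℝ] E) =
      (A : E →ₗ[ℝ] E) * ((complexJ E : E →ₗ[ℝ] E) * (B : E →ₗ[ℝ] E)) := by
    ext v
    simp [hA]
  rw [h2, h1]
  rfl

/-- The connection form whose exterior derivative is twice the Ricci form. -/
def ricciPotential (G : E → E →L[ℝ] E →L[ℝ] ℝ) (y : E) : E →L[ℝ] ℝ :=
  traceJ E ∘L christoffel G y

theorem contDiffOn_ricciPotential (h : IsKahlerOn G U) : ContDiffOn ℝ ∞ (ricciPotential G) U :=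
  contDiffOn_const.clm_comp h.contDiffOn_christoffel

/-- Apply $\mathrm{tr}(J\,\cdot)$ to
$R(u,v)=\partial_u\Gamma_v-\partial_v\Gamma_u+[\Gamma_u,\Gamma_v]$. The commutator drops out because
$\Gamma_u$ commutes with $J$, and Bianchi rewrites $JR(u,v)$ as a difference of two operators whose
traces are Ricci terms. The Ricci form is thus locally exact, without any differentiation of the
curvature. -/
theorem fderiv_ricciPotential (h : IsKahlerOn G U) (hy : y ∈ U) (u v : E) :
    fderiv ℝ (ricciPotential G) y u v - fderiv ℝ (ricciPotential G) y v u =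
      ricci G y v (Complex.I • u) - ricci G y u (Complex.I • v) := by
  have hd := h.differentiableAt_christoffel hy
  have e (a b : E) : fderiv ℝ (ricciPotential G) y a b =
      traceJ E (fderiv ℝ (christoffel G) y a b) := by
    have : HasFDerivAt (ricciPotential G)
        ((ContinuousLinearMap.compL ℝ E (E →L[ℝ] E) ℝ (traceJ E)) ∘L fderiv ℝ (christoffel G) y)
        y := (ContinuousLinearMap.compL ℝ E (E →L[ℝ] E) ℝ (traceJ E)).hasFDerivAt.comp y
          hd.hasFDerivAt
    rw [this.fderiv]
    rfl
  have hc := traceJ_comp_comm (A := christoffel G y u) (B := christoffel G y v)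
    (h.christoffel_I_right hy u)
  have key : complexJ E ∘L (fderiv ℝ (christoffel G) y u v - fderiv ℝ (christoffel G) y v u
      + christoffel G y u ∘L christoffel G y v - christoffel G y v ∘L christoffel G y u) =
      curvature G y v (Complex.I • u) - curvature G y u (Complex.I • v) := by
    ext w
    have b := h.curvature_bianchi hy u v w
    rw [curvature_antisymm G y v w u] at b
    have b' : curvature G y v w u = curvature G y v u w - curvature G y u v w := by
      rw [← sub_eq_zero, ← b]; abel
    rw [sub_apply, h.curvature_I hy, h.curvature_I hy, ← smul_sub, ← b', curvature_apply]
    rfl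
  have t := congrArg (fun A : E →L[ℝ] E => LinearMap.trace ℝ E (A : E →ₗ[ℝ] E)) key
  simp only [← traceJ_apply, ContinuousLinearMap.toLinearMap_sub, map_sub, map_add] at t
  rw [e, e, ricci, ricci, ← t, hc]
  ring

end IsKahlerOn

end LocalMetric

/-! ### Conformal change of connection, Hessian and Ricci tensor -/

namespace LocalMetric

section Riemannian

variable {E : Type*} [NormedAddCommGroup E] [NormedSpace ℝ E]

/-- The covariant derivative `u ↦ ∇_u ∇F` of the gradient. -/
def gradientDeriv (G : E → E →L[ℝ] E →L[ℝ] ℝ) (F : E → ℝ) (y : E) : E →L[ℝ] E :=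
  fderiv ℝ (gradient G F) y + (christoffel G y).flip (gradient G F y)

theorem gradientDeriv_apply (G : E → E →L[ℝ] E →L[ℝ] ℝ) (F : E → ℝ) (y u : E) :
    gradientDeriv G F y u = fderiv ℝ (gradient G F) y u + christoffel G y u (gradient G F y) := rfl

/-- The Laplacian of a function. -/
def laplacian (G : E → E →L[ℝ] E →L[ℝ] ℝ) (F : E → ℝ) (y : E) : ℝ :=
  LinearMap.trace ℝ E (gradientDeriv G F y : E →ₗ[ℝ] E)

namespace IsMetricOn

variable {G : E → E →L[ℝ] E →L[ℝ] ℝ} {U : Set E} {y : E} {F : E → ℝ}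

theorem differentiableAt_fderiv (h : IsMetricOn G U) (hF : ContDiffOn ℝ ∞ F U) (hy : y ∈ U) :
    DifferentiableAt ℝ (fderiv ℝ F) y :=
  ((hF.fderiv_of_isOpen (m := ∞) h.isOpen (by simp)).contDiffAt
    (h.isOpen.mem_nhds hy)).differentiableAt (by simp)

variable [FiniteDimensional ℝ E]

theorem apply_gradient (h : IsMetricOn G U) (hy : y ∈ U) (F : E → ℝ) (w : E) :
    G y (gradient G F y) w = fderiv ℝ F y w := by
  rw [gradient, h.apply_inverse hy]

theorem contDiffOn_gradient (h : IsMetricOn G U) (hF : ContDiffOn ℝ ∞ F U) :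
    ContDiffOn ℝ ∞ (gradient G F) U :=
  h.contDiffOn_inverse.clm_apply (hF.fderiv_of_isOpen h.isOpen (by simp))

theorem differentiableAt_gradient (h : IsMetricOn G U) (hF : ContDiffOn ℝ ∞ F U) (hy : y ∈ U) :
    DifferentiableAt ℝ (gradient G F) y :=
  ((h.contDiffOn_gradient hF).contDiffAt (h.isOpen.mem_nhds hy)).differentiableAt (by simp)

theorem hessian_symm (h : IsMetricOn G U) (hF : ContDiffOn ℝ ∞ F U) (hy : y ∈ U) (u v : E) :
    hessian G F y u v = hessian G F y v u := by
  rw [hessian, hessian, fderiv_fderiv_comm (hF.contDiffAt (h.isOpen.mem_nhds hy)),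
    h.christoffel_symm hy]

theorem apply_gradientDeriv (h : IsMetricOn G U) (hF : ContDiffOn ℝ ∞ F U) (hy : y ∈ U) (u w : E) :
    G y (gradientDeriv G F y u) w = hessian G F y u w := by
  have hX := h.differentiableAt_gradient hF hy
  have hG := h.differentiableAt hy
  have e : (fun z => G z (gradient G F z) w) =ᶠ[𝓝 y] fun z => fderiv ℝ F z w := by
    filter_upwards [h.isOpen.mem_nhds hy] with z hz using h.apply_gradient hz F w
  have e' : fderiv ℝ (fun z => G z (gradient G F z) w) y u =
      fderiv ℝ (fun z => fderiv ℝ F z w) y u := by rw [e.fderiv_eq]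
  rw [fderiv_apply (hG.clm_apply hX), fderiv_clm_apply' hG hX,
    fderiv_apply (h.differentiableAt_fderiv hF hy), add_apply, h.fderiv_eq hy,
    h.apply_gradient hy] at e'
  rw [gradientDeriv_apply, hessian, map_add, add_apply, ← e']
  ring

variable {Ghat : E → E →L[ℝ] E →L[ℝ] ℝ} {σ : E → ℝ}

/-- The Levi-Civita connection of `exp (-2σ) G`. -/
theorem christoffel_conformal (h : IsMetricOn G U) (hhat : IsMetricOn Ghat U)
    (hσ : ContDiffOn ℝ ∞ σ U) (hc : ∀ z ∈ U, Ghat z = Real.exp (-2 * σ z) • G z)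
    (hy : y ∈ U) (u v : E) :
    christoffel Ghat y u v = christoffel G y u v - fderiv ℝ σ y u • v - fderiv ℝ σ y v • u
      + G y u v • gradient G σ y := by
  have hG := h.differentiableAt hy
  have hσ' : DifferentiableAt ℝ σ y :=
    (hσ.contDiffAt (h.isOpen.mem_nhds hy)).differentiableAt (by simp)
  have d (a b c : E) : fderiv ℝ Ghat y a b c =
      Real.exp (-2 * σ y) * (fderiv ℝ G y a b c - 2 * fderiv ℝ σ y a * G y b c) := by
    have e : (fun z => Ghat z b c) =ᶠ[𝓝 y] fun z => Real.exp (-2 * σ z) * G z b c := by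
      filter_upwards [h.isOpen.mem_nhds hy] with z hz
      rw [hc z hz]; rfl
    have h1 := ((hσ'.hasFDerivAt.const_mul (-2)).exp).mul
      (hasFDerivAt_apply (hasFDerivAt_apply hG b).differentiableAt c)
    rw [← fderiv_apply₂ (hhat.differentiableAt hy), e.fderiv_eq]
    have h2 := congrArg (fun L : E →L[ℝ] ℝ => L a) h1.fderiv
    refine h2.trans ?_
    simp only [add_apply, smul_apply, ContinuousLinearMap.flip_apply, smul_eq_mul,
      fderiv_apply hG]
    ring
  refine hhat.ext hy fun w => ?_
  rw [hhat.apply_christoffel hy, d, d, d, hc y hy, smul_apply, smul_apply, smul_eq_mul]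
  simp only [map_add, map_sub, map_smul, add_apply, sub_apply, smul_apply, smul_eq_mul,
    h.apply_christoffel hy, h.apply_gradient hy]
  ring

theorem hessian_conformal (h : IsMetricOn G U) (hhat : IsMetricOn Ghat U)
    (hσ : ContDiffOn ℝ ∞ σ U) (hc : ∀ z ∈ U, Ghat z = Real.exp (-2 * σ z) • G z)
    (hy : y ∈ U) (F : E → ℝ) (u v : E) :
    hessian Ghat F y u v = hessian G F y u v + fderiv ℝ σ y u * fderiv ℝ F y v
      + fderiv ℝ σ y v * fderiv ℝ F y u - G y u v * fderiv ℝ F y (gradient G σ y) := by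
  rw [hessian, hessian, h.christoffel_conformal hhat hσ hc hy]
  simp only [map_add, map_sub, map_smul, smul_eq_mul]
  ring

theorem curvature_conformal (h : IsMetricOn G U) (hhat : IsMetricOn Ghat U)
    (hσ : ContDiffOn ℝ ∞ σ U) (hc : ∀ z ∈ U, Ghat z = Real.exp (-2 * σ z) • G z)
    (hy : y ∈ U) (u v w : E) :
    curvature Ghat y v w u = curvature G y v w u
      + (hessian G σ y v w + fderiv ℝ σ y v * fderiv ℝ σ y w
          - fderiv ℝ σ y (gradient G σ y) * G y v w) • u
      - (hessian G σ y u w + fderiv ℝ σ y u * fderiv ℝ σ y w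
          - fderiv ℝ σ y (gradient G σ y) * G y u w) • v
      + G y v w • gradientDeriv G σ y u - G y u w • gradientDeriv G σ y v
      + (G y v w * fderiv ℝ σ y u - fderiv ℝ σ y v * G y u w) • gradient G σ y := by
  have hG := h.differentiableAt hy
  have hX := h.differentiableAt_gradient hσ hy
  have hΓ := h.differentiableAt_christoffel hy
  have hdσ := h.differentiableAt_fderiv hσ hy
  have d (a b c : E) : fderiv ℝ (christoffel Ghat) y a b c = fderiv ℝ (christoffel G) y a b c
      - fderiv ℝ (fderiv ℝ σ) y a b • c - fderiv ℝ (fderiv ℝ σ) y a c • b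
      + (fderiv ℝ G y a b c • gradient G σ y + G y b c • fderiv ℝ (gradient G σ) y a) := by
    have e : (fun z => christoffel Ghat z b c) =ᶠ[𝓝 y] fun z => christoffel G z b c
        - fderiv ℝ σ z b • c - fderiv ℝ σ z c • b + G z b c • gradient G σ z := by
      filter_upwards [h.isOpen.mem_nhds hy] with z hz
        using h.christoffel_conformal hhat hσ hc hz b c
    have h1 := (((hasFDerivAt_apply (hasFDerivAt_apply hΓ b).differentiableAt c).sub
      ((hasFDerivAt_apply hdσ b).smul_const c)).sub ((hasFDerivAt_apply hdσ c).smul_const b)).add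
      ((hasFDerivAt_apply (hasFDerivAt_apply hG b).differentiableAt c).smul hX.hasFDerivAt)
    rw [← fderiv_apply₂ (hhat.differentiableAt_christoffel hy), e.fderiv_eq]
    refine (congrArg (fun L : E →L[ℝ] E => L a) h1.fderiv).trans ?_
    simp only [add_apply, sub_apply, smul_apply, ContinuousLinearMap.flip_apply,
      ContinuousLinearMap.smulRight_apply, fderiv_apply hG, fderiv_apply hΓ]
    abel
  have hs := h.hessian_symm hσ hy u v
  simp only [hessian] at hs
  simp only [curvature_apply, h.christoffel_conformal hhat hσ hc hy, d, hessian,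
    gradientDeriv_apply, map_add, map_sub, map_smul, smul_eq_mul, h.fderiv_eq hy,
    h.apply_gradient hy, h.symm y hy _ (gradient G σ y)]
  rw [fderiv_fderiv_comm (hσ.contDiffAt (h.isOpen.mem_nhds hy)) v u,
    h.christoffel_symm hy v u, h.symm y hy v (christoffel G y u w), h.symm y hy v u]
  rw [h.symm y hy u (christoffel G y v w)]
  module

/-- The Ricci tensor of `exp (-2σ) G`. -/
theorem ricci_conformal (h : IsMetricOn G U) (hhat : IsMetricOn Ghat U)
    (hσ : ContDiffOn ℝ ∞ σ U) (hc : ∀ z ∈ U, Ghat z = Real.exp (-2 * σ z) • G z)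
    (hy : y ∈ U) (v w : E) :
    ricci Ghat y v w = ricci G y v w
      + ((Module.finrank ℝ E : ℝ) - 2) *
        (hessian G σ y v w + fderiv ℝ σ y v * fderiv ℝ σ y w)
      + (laplacian G σ y - ((Module.finrank ℝ E : ℝ) - 2) * fderiv ℝ σ y (gradient G σ y))
        * G y v w := by
  set t := fderiv ℝ σ y (gradient G σ y)
  set A := hessian G σ y v w + fderiv ℝ σ y v * fderiv ℝ σ y w - t * G y v w
  set L : E →L[ℝ] ℝ := (fderiv ℝ (fderiv ℝ σ) y).flip w
    - fderiv ℝ σ y ∘L (christoffel G y).flip w + fderiv ℝ σ y w • fderiv ℝ σ y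
    - t • G y w
  set K : E →L[ℝ] ℝ := G y v w • fderiv ℝ σ y - fderiv ℝ σ y v • G y w
  -- As an operator in $u$, the correction consists of a multiple of the identity, a multiple of
  -- $\nabla\nabla\sigma$ and rank-one operators, whose traces are evaluations of the functionals.
  have key : (curvature Ghat y v w : E →ₗ[ℝ] E) = (curvature G y v w : E →ₗ[ℝ] E)
      + A • LinearMap.id - (L : E →ₗ[ℝ] ℝ).smulRight v + G y v w • (gradientDeriv G σ y : E →ₗ[ℝ] E)
      - (G y w : E →ₗ[ℝ] ℝ).smulRight (gradientDeriv G σ y v) + (K : E →ₗ[ℝ] ℝ).smulRight (gradient G σ y) := by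
    ext u
    have := h.curvature_conformal hhat hσ hc hy u v w
    simp only [ContinuousLinearMap.coe_coe, this, LinearMap.add_apply, LinearMap.sub_apply,
      LinearMap.smul_apply, LinearMap.smulRight_apply, LinearMap.id_apply, L, K, A, hessian,
      add_apply, sub_apply, smul_apply, smul_eq_mul, ContinuousLinearMap.flip_apply,
      ContinuousLinearMap.comp_apply, h.symm y hy w u]
    simp only [mul_comm, t]
  have hL : L v = A := by
    simp only [L, A, add_apply, sub_apply, smul_apply, smul_eq_mul,
      ContinuousLinearMap.flip_apply, ContinuousLinearMap.comp_apply, h.symm y hy w v, hessian]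
    ring
  have hN : (G y w) (gradientDeriv G σ y v) = hessian G σ y v w := by
    rw [h.symm y hy, h.apply_gradientDeriv hσ hy]
  have hK : K (gradient G σ y) = G y v w * t - fderiv ℝ σ y v * fderiv ℝ σ y w := by
    simp only [K, sub_apply, smul_apply, smul_eq_mul,
      h.symm y hy w, h.apply_gradient hy, t]
  rw [ricci, key]
  simp only [map_add, map_sub, map_smul, LinearMap.trace_smulRight, LinearMap.trace_id, hL, hK,
    ContinuousLinearMap.coe_coe, hN, smul_eq_mul]
  rw [ricci, laplacian]
  simp only [A]
  ring

end IsMetricOn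

end Riemannian

/-! ### Hessians of Killing potentials -/

section Kahler

variable {E : Type*} [NormedAddCommGroup E] [NormedSpace ℂ E] [FiniteDimensional ℂ E]
  {G : E → E →L[ℝ] E →L[ℝ] ℝ} {U : Set E} {y : E} {F : E → ℝ}

/-- The Hessian of a Killing potential is hermitian. -/
theorem IsKahlerOn.hessian_I_I (h : IsKahlerOn G U) (hF : ContDiffOn ℝ ∞ F U) (hy : y ∈ U)
    (hK : ∀ v w, lieDerivative G (fun z => Complex.I • gradient G F z) y v w = 0) (v w : E) :
    hessian G F y (Complex.I • v) (Complex.I • w) = hessian G F y v w := by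
  have hX := h.differentiableAt_gradient hF hy
  have d (u : E) : fderiv ℝ (fun z => Complex.I • gradient G F z) y u =
      Complex.I • fderiv ℝ (gradient G F) y u :=
    congrArg (fun L : E →L[ℝ] E => L u)
      ((complexJ E).hasFDerivAt.comp y hX.hasFDerivAt).fderiv
  -- The Killing equation says that $\nabla(J\nabla F)=J\nabla\nabla F$ is skew; hermitian symmetry
  -- follows from this and the symmetry of the Hessian.
  have key (a b : E) : hessian G F y a (Complex.I • b) = - hessian G F y b (Complex.I • a) := by
    have h1 := hK a b
    rw [lieDerivative, d, d, h.fderiv_eq hy, h.christoffel_I_left hy, h.christoffel_I_left hy,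
      h.christoffel_symm hy _ a, h.christoffel_symm hy _ b] at h1
    have h2 := h.apply_gradientDeriv hF hy a (Complex.I • b)
    have h3 := h.apply_gradientDeriv hF hy b (Complex.I • a)
    rw [gradientDeriv_apply, map_add, add_apply] at h2 h3
    rw [h.symm y hy a, h.symm y hy a] at h1
    simp only [h.apply_I_left hy] at h1
    linarith
  have h1 := key (Complex.I • v) w
  rw [I_smul_I_smul] at h1
  have h2 := key (Complex.I • v) (Complex.I • w)
  rw [I_smul_I_smul, I_smul_I_smul] at h2
  have e1 : hessian G F y (Complex.I • w) (-v) = - hessian G F y (Complex.I • w) v := by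
    simp [hessian]; ring
  have e2 : hessian G F y (Complex.I • v) (-w) = - hessian G F y (Complex.I • v) w := by
    simp [hessian]; ring
  have h3 := key v (Complex.I • w)
  rw [I_smul_I_smul] at h3
  have e3 : hessian G F y v (-w) = - hessian G F y v w := by
    simp [hessian]; ring
  have s := h.hessian_symm hF hy (Complex.I • w) (Complex.I • v)
  linarith

end Kahler

end LocalMetric

namespace LocalMetric

variable {E : Type*} [NormedAddCommGroup E] [NormedSpace ℂ E]

/-! ### A second-order system of finite type and its unique continuation -/

section UniqueContinuation

variable {U : Set E} {y : E} {w : E → ℝ} {P : E → E →L[ℝ] E →L[ℝ] E}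

/-- Third derivatives of a solution of `D²w(u, v) - D²w(iu, iv) = dw(P(u, v))` are controlled by
its first and second derivatives. -/
theorem norm_fderiv_fderiv_fderiv_le (hU : IsOpen U) (hw : ContDiffOn ℝ ∞ w U)
    (hP : ContDiffOn ℝ ∞ P U)
    (heq : ∀ y ∈ U, ∀ u v, fderiv ℝ (fderiv ℝ w) y u v
      - fderiv ℝ (fderiv ℝ w) y (Complex.I • u) (Complex.I • v) = fderiv ℝ w y (P y u v))
    (hy : y ∈ U) :
    ‖fderiv ℝ (fderiv ℝ (fderiv ℝ w)) y‖ ≤ 2 * (‖P y‖ + ‖fderiv ℝ P y‖) *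
      max ‖fderiv ℝ w y‖ ‖fderiv ℝ (fderiv ℝ w) y‖ := by
  have hw1 : ContDiffOn ℝ ∞ (fderiv ℝ w) U := hw.fderiv_of_isOpen hU (by simp)
  have hw2 : ContDiffOn ℝ ∞ (fderiv ℝ (fderiv ℝ w)) U := hw1.fderiv_of_isOpen hU (by simp)
  have d1 : DifferentiableAt ℝ (fderiv ℝ w) y :=
    (hw1.contDiffAt (hU.mem_nhds hy)).differentiableAt (by simp)
  have d2 : DifferentiableAt ℝ (fderiv ℝ (fderiv ℝ w)) y :=
    (hw2.contDiffAt (hU.mem_nhds hy)).differentiableAt (by simp)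
  have dP : DifferentiableAt ℝ P y :=
    (hP.contDiffAt (hU.mem_nhds hy)).differentiableAt (by simp)
  have dP' (u v : E) : DifferentiableAt ℝ (fun z => P z u v) y :=
    (hasFDerivAt_apply (hasFDerivAt_apply dP u).differentiableAt v).differentiableAt
  set T := fderiv ℝ (fderiv ℝ (fderiv ℝ w)) y with hT
  have s1 (a u v : E) : T a u v = T u a v := by
    rw [hT, fderiv_fderiv_comm (hw1.contDiffAt (hU.mem_nhds hy))]
  have s2 (a u v : E) : T a u v = T a v u := by
    rw [hT, ← fderiv_apply₂ d2, ← fderiv_apply₂ d2]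
    congr 1
    apply Filter.EventuallyEq.fderiv_eq
    filter_upwards [hU.mem_nhds hy] with z hz
      using fderiv_fderiv_comm (hw.contDiffAt (hU.mem_nhds hz)) u v
  set L : E → E → E → ℝ := fun a u v =>
    fderiv ℝ (fderiv ℝ w) y a (P y u v) + fderiv ℝ w y (fderiv ℝ P y a u v) with hL
  have hTL (a u v : E) : T a u v - T a (Complex.I • u) (Complex.I • v) = L a u v := by
    have e : (fun z => fderiv ℝ (fderiv ℝ w) z u v
        - fderiv ℝ (fderiv ℝ w) z (Complex.I • u) (Complex.I • v)) =ᶠ[𝓝 y]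
        fun z => fderiv ℝ w z (P z u v) := by
      filter_upwards [hU.mem_nhds hy] with z hz using heq z hz u v
    have e' : fderiv ℝ (fun z => fderiv ℝ (fderiv ℝ w) z u v
        - fderiv ℝ (fderiv ℝ w) z (Complex.I • u) (Complex.I • v)) y a =
        fderiv ℝ (fun z => fderiv ℝ w z (P z u v)) y a := by rw [e.fderiv_eq]
    rw [fderiv_fun_sub
      (hasFDerivAt_apply (hasFDerivAt_apply d2 _).differentiableAt _).differentiableAt
      (hasFDerivAt_apply (hasFDerivAt_apply d2 _).differentiableAt _).differentiableAt,
      sub_apply, fderiv_apply₂ d2, fderiv_apply₂ d2, fderiv_clm_apply' d1 (dP' u v),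
      fderiv_apply₂ dP] at e'
    exact e'
  set m := max ‖fderiv ℝ w y‖ ‖fderiv ℝ (fderiv ℝ w) y‖
  have hm : 0 ≤ m := (norm_nonneg _).trans (le_max_left _ _)
  set K := ‖P y‖ + ‖fderiv ℝ P y‖
  have hLb (a u v : E) : |L a u v| ≤ K * m * ‖a‖ * ‖u‖ * ‖v‖ := by
    have b1 : |fderiv ℝ (fderiv ℝ w) y a (P y u v)| ≤ m * ‖a‖ * (‖P y‖ * ‖u‖ * ‖v‖) := by
      refine ((fderiv ℝ (fderiv ℝ w) y).le_opNorm₂ a (P y u v)).trans ?_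
      gcongr
      · exact le_max_right _ _
      · exact (P y).le_opNorm₂ u v
    have b2 : |fderiv ℝ w y (fderiv ℝ P y a u v)| ≤ m * (‖fderiv ℝ P y‖ * ‖a‖ * ‖u‖ * ‖v‖) := by
      refine ((fderiv ℝ w y).le_opNorm _).trans ?_
      gcongr
      · exact le_max_left _ _
      · refine ((fderiv ℝ P y a).le_opNorm₂ u v).trans ?_
        gcongr
        exact (fderiv ℝ P y).le_opNorm a
    calc |L a u v| ≤ _ := abs_add_le _ _
      _ ≤ _ := add_le_add b1 b2
      _ = _ := by simp only [K]; ring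
  have hI (v : E) : ‖Complex.I • v‖ = ‖v‖ := by rw [norm_smul, Complex.norm_I, one_mul]
  have key (a u v : E) : ‖T a u v‖ ≤ 2 * K * m * ‖a‖ * ‖u‖ * ‖v‖ := by
    -- The equation controls only $T(a,u,v)-T(a,iu,iv)$. In these three instances the terms carrying
    -- two factors $i$ cancel by the total symmetry of $T$, leaving $2T(a,u,v)$.
    have e : 2 * T a u v = L a u v + L (Complex.I • u) a (Complex.I • v) + L v u a := by
      have h1 := hTL a u v
      have h2 := hTL (Complex.I • u) a (Complex.I • v)
      have h3 := hTL v u a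
      rw [I_smul_I_smul, map_neg] at h2
      have := s1 a (Complex.I • u) (Complex.I • v)
      have := s2 (Complex.I • u) (Complex.I • a) v
      have := s1 (Complex.I • u) v (Complex.I • a)
      have := s2 v u a
      have := s1 v a u
      have := s2 a v u
      linarith
    have b1 := hLb a u v
    have b2 := hLb (Complex.I • u) a (Complex.I • v)
    have b3 := hLb v u a
    rw [hI, hI] at b2
    have hn : 0 ≤ K * m * ‖a‖ * ‖u‖ * ‖v‖ := by positivity
    have e2 : K * m * ‖u‖ * ‖a‖ * ‖v‖ = K * m * ‖a‖ * ‖u‖ * ‖v‖ := by ring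
    have e3 : K * m * ‖v‖ * ‖u‖ * ‖a‖ = K * m * ‖a‖ * ‖u‖ * ‖v‖ := by ring
    rw [e2] at b2
    rw [e3] at b3
    have e4 : 2 * K * m * ‖a‖ * ‖u‖ * ‖v‖ = 2 * (K * m * ‖a‖ * ‖u‖ * ‖v‖) := by ring
    rw [Real.norm_eq_abs, e4]
    rw [abs_le] at b1 b2 b3 ⊢
    constructor <;> linarith [b1.1, b1.2, b2.1, b2.2, b3.1, b3.2]
  refine ContinuousLinearMap.opNorm_le_bound _ (by positivity) fun a => ?_
  refine ContinuousLinearMap.opNorm_le_bound _ (by positivity) fun u => ?_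
  exact ContinuousLinearMap.opNorm_le_bound _ (by positivity) fun v => key a u v

/-- Unique continuation for `D²w(u, v) - D²w(iu, iv) = dw(P(u, v))`. -/
theorem eq_zero_of_jet_eq_zero (hU : IsOpen U) (hconv : Convex ℝ U) (hw : ContDiffOn ℝ ∞ w U)
    (hP : ContDiffOn ℝ ∞ P U)
    (heq : ∀ y ∈ U, ∀ u v, fderiv ℝ (fderiv ℝ w) y u v
      - fderiv ℝ (fderiv ℝ w) y (Complex.I • u) (Complex.I • v) = fderiv ℝ w y (P y u v))
    {q x : E} (hq : q ∈ U) (h0 : w q = 0) (h1 : fderiv ℝ w q = 0)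
    (h2 : fderiv ℝ (fderiv ℝ w) q = 0) (hx : x ∈ U) : w x = 0 := by
  have hw1 : ContDiffOn ℝ ∞ (fderiv ℝ w) U := hw.fderiv_of_isOpen hU (by simp)
  have hw2 : ContDiffOn ℝ ∞ (fderiv ℝ (fderiv ℝ w)) U := hw1.fderiv_of_isOpen hU (by simp)
  set c : ℝ → E := fun t => q + t • (x - q) with hc
  have hcU : ∀ t ∈ Set.Icc (0 : ℝ) 1, c t ∈ U := fun t ht =>
    hconv.add_smul_sub_mem hq hx ht
  have hcd (t : ℝ) : HasDerivAt c (x - q) t := by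
    simpa [hc] using ((hasDerivAt_id t).smul_const (x - q)).const_add q
  have hcc : Continuous c := by fun_prop
  have hPc : ContinuousOn (fun t => 2 * (‖P (c t)‖ + ‖fderiv ℝ P (c t)‖)) (Set.Icc (0 : ℝ) 1) := by
    have p1 := hP.continuousOn.comp hcc.continuousOn hcU
    have p2 := (hP.fderiv_of_isOpen (m := ∞) hU (by simp)).continuousOn.comp hcc.continuousOn hcU
    exact continuousOn_const.mul (p1.norm.add p2.norm)
  obtain ⟨C, hC⟩ := isCompact_Icc.exists_bound_of_continuousOn hPc
  -- The 2-jet along the segment from $q$ to $x$ satisfies a linear differential inequality, to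
  -- which Grönwall applies with zero initial value.
  set Y : ℝ → ℝ × (E →L[ℝ] ℝ) × (E →L[ℝ] E →L[ℝ] ℝ) := fun t =>
    (w (c t), fderiv ℝ w (c t), fderiv ℝ (fderiv ℝ w) (c t)) with hY
  set Y' : ℝ → ℝ × (E →L[ℝ] ℝ) × (E →L[ℝ] E →L[ℝ] ℝ) := fun t =>
    (fderiv ℝ w (c t) (x - q), fderiv ℝ (fderiv ℝ w) (c t) (x - q),
      fderiv ℝ (fderiv ℝ (fderiv ℝ w)) (c t) (x - q)) with hY'
  have hder : ∀ t ∈ Set.Icc (0 : ℝ) 1, HasDerivAt Y (Y' t) t := by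
    intro t ht
    have hn := hU.mem_nhds (hcU t ht)
    have a0 := ((hw.contDiffAt hn).differentiableAt (by simp)).hasFDerivAt.comp_hasDerivAt t (hcd t)
    have a1 :=
      ((hw1.contDiffAt hn).differentiableAt (by simp)).hasFDerivAt.comp_hasDerivAt t (hcd t)
    have a2 :=
      ((hw2.contDiffAt hn).differentiableAt (by simp)).hasFDerivAt.comp_hasDerivAt t (hcd t)
    exact a0.prodMk (a1.prodMk a2)
  -- The first two components of $Y'$ are bounded by $\|x-q\|\,\|Y\|$ and the third by $C$ times
  -- that; $1+C$ covers both cases.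
  have hb : ∀ t ∈ Set.Ico (0 : ℝ) 1, ‖Y' t‖ ≤ ((1 + C) * ‖x - q‖) * ‖Y t‖ + 0 := by
    intro t ht
    have ht' := Set.Ico_subset_Icc_self ht
    have hCt := (le_abs_self _).trans (hC t ht')
    have n1 : ‖fderiv ℝ w (c t)‖ ≤ ‖Y t‖ := (norm_fst_le (Y t).2).trans (norm_snd_le (Y t))
    have n2 : ‖fderiv ℝ (fderiv ℝ w) (c t)‖ ≤ ‖Y t‖ :=
      (norm_snd_le (Y t).2).trans (norm_snd_le (Y t))
    have hC0 : 0 ≤ C := (by positivity : (0:ℝ) ≤ 2 * (‖P (c t)‖ + ‖fderiv ℝ P (c t)‖)).trans hCt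
    have n3 : ‖fderiv ℝ (fderiv ℝ (fderiv ℝ w)) (c t)‖ ≤ C * ‖Y t‖ := by
      refine (norm_fderiv_fderiv_fderiv_le hU hw hP heq (hcU t ht')).trans ?_
      gcongr
      exact max_le n1 n2
    have hYn := norm_nonneg (Y t)
    have hCY : 0 ≤ C * ‖Y t‖ := by positivity
    rw [add_zero, mul_right_comm]
    refine norm_prod_le_iff.2 ⟨?_, norm_prod_le_iff.2 ⟨?_, ?_⟩⟩
    · refine (ContinuousLinearMap.le_opNorm _ _).trans ?_
      gcongr
      linarith
    · refine (ContinuousLinearMap.le_opNorm _ _).trans ?_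
      gcongr
      linarith
    · refine (ContinuousLinearMap.le_opNorm _ _).trans ?_
      gcongr
      linarith
  have hc0 : c 0 = q := by simp [hc]
  have hc1 : c 1 = x := by simp [hc]
  have hY0 : ‖Y 0‖ ≤ 0 := by simp [hY, hc0, h0, h1, h2]
  have hg := norm_le_gronwallBound_of_norm_deriv_right_le
    (fun t ht => (hder t ht).continuousAt.continuousWithinAt)
    (fun t ht => (hder t (Set.Ico_subset_Icc_self ht)).hasDerivWithinAt) hY0 hb 1
    (by simp)
  rw [gronwallBound_ε0_δ0] at hg
  have := (norm_fst_le (Y 1)).trans hg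
  simpa [hY, hc1] using this

end UniqueContinuation

/-! ### Constancy of the soliton coefficient -/

variable [FiniteDimensional ℂ E] {G : E → E →L[ℝ] E →L[ℝ] ℝ} {U : Set E} {y : E} {F γ : E → ℝ}

/-- The coefficient of a gradient Kähler–Ricci almost soliton is locally constant. -/
theorem IsKahlerOn.hasFDerivAt_zero_of_ricci_sub_hessian (h : IsKahlerOn G U)
    (hdim : 3 ≤ Module.finrank ℝ E) (hF : ContDiffOn ℝ ∞ F U)
    (heq : ∀ y ∈ U, ∀ v w, ricci G y v w - hessian G F y v w = γ y * G y v w) (hy : y ∈ U) :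
    HasFDerivAt γ (0 : E →L[ℝ] ℝ) y := by
  have := FiniteDimensional.complexToReal E
  have hn {z : E} (hz : z ∈ U) := h.isOpen.mem_nhds hz
  have hF1 : ContDiffOn ℝ ∞ (fderiv ℝ F) U := hF.fderiv_of_isOpen h.isOpen (by simp)
  have hα := h.contDiffOn_ricciPotential
  have hβ : ContDiffOn ℝ ∞ (fun z => fderiv ℝ F z ∘L complexJ E) U := hF1.clm_comp contDiffOn_const
  -- A local primitive of $2\gamma\omega$: the two summands account for the Ricci tensor and the
  -- Hessian.
  set κ : E → E →L[ℝ] ℝ := fun z => ricciPotential G z + fderiv ℝ F z ∘L complexJ E with hκ'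
  have hκ : ContDiffOn ℝ ∞ κ U := hα.add hβ
  have hκ1 : ContDiffOn ℝ ∞ (fderiv ℝ κ) U := hκ.fderiv_of_isOpen h.isOpen (by simp)
  have hDκ : ∀ z ∈ U, ∀ u v, fderiv ℝ κ z u v - fderiv ℝ κ z v u =
      2 * γ z * G z (Complex.I • u) v := by
    intro z hz u v
    have hdβ (a b : E) : fderiv ℝ (fun z => fderiv ℝ F z ∘L complexJ E) z a b =
        fderiv ℝ (fderiv ℝ F) z a (Complex.I • b) := by
      rw [← fderiv_apply (((hβ.contDiffAt (hn hz))).differentiableAt (by simp)),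
        ← fderiv_apply ((hF1.contDiffAt (hn hz)).differentiableAt (by simp))]
      rfl
    have hd (a b : E) : fderiv ℝ κ z a b = fderiv ℝ (ricciPotential G) z a b
        + fderiv ℝ (fderiv ℝ F) z a (Complex.I • b) := by
      rw [hκ', fderiv_fun_add ((hα.contDiffAt (hn hz)).differentiableAt (by simp))
        ((hβ.contDiffAt (hn hz)).differentiableAt (by simp)), add_apply, add_apply, hdβ]
    have r := h.fderiv_ricciPotential hz u v
    have e1 := heq z hz v (Complex.I • u)
    have e2 := heq z hz u (Complex.I • v)
    rw [hessian, h.christoffel_I_right hz] at e1 e2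
    rw [h.christoffel_symm hz v u] at e1
    rw [h.symm z hz v] at e1
    have e3 := h.apply_I_left hz u v
    rw [hd, hd]
    rw [show G z u (Complex.I • v) = - G z (Complex.I • u) v by linarith] at e2
    linarith
  have hdG := h.differentiableAt hy
  have hdκ : DifferentiableAt ℝ (fderiv ℝ κ) y :=
    (hκ1.contDiffAt (hn hy)).differentiableAt (by simp)
  have hdκ' (a b : E) : DifferentiableAt ℝ (fun z => fderiv ℝ κ z a b) y :=
    (hasFDerivAt_apply (hasFDerivAt_apply hdκ a).differentiableAt b).differentiableAt
  have hdG' (a b : E) : DifferentiableAt ℝ (fun z => G z a b) y :=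
    (hasFDerivAt_apply (hasFDerivAt_apply hdG a).differentiableAt b).differentiableAt
  have hI0 {v : E} (hv : v ≠ 0) : Complex.I • v ≠ 0 := smul_ne_zero Complex.I_ne_zero hv
  have hnt : Nontrivial E := Module.nontrivial_of_finrank_pos (R := ℝ) (by omega)
  -- No regularity of $\gamma$ is assumed; it is recovered as a quotient of smooth functions by
  -- evaluating $d\kappa=2\gamma\omega$ on $(v,iv)$.
  have hγ : DifferentiableAt ℝ γ y := by
    obtain ⟨v, hv⟩ := exists_ne (0 : E)
    have e : γ =ᶠ[𝓝 y] fun z => (fderiv ℝ κ z v (Complex.I • v) - fderiv ℝ κ z (Complex.I • v) v) *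
        (2 * G z (Complex.I • v) (Complex.I • v))⁻¹ := by
      filter_upwards [hn hy] with z hz
      have := h.pos z hz _ (hI0 hv)
      rw [hDκ z hz]
      field_simp
    refine DifferentiableAt.congr_of_eventuallyEq ?_ e
    have hne : 2 * G y (Complex.I • v) (Complex.I • v) ≠ 0 :=
      mul_ne_zero two_ne_zero (h.pos y hy _ (hI0 hv)).ne'
    exact ((hdκ' v (Complex.I • v)).fun_sub (hdκ' (Complex.I • v) v)).fun_mul
      (((hdG' (Complex.I • v) (Complex.I • v)).const_mul 2).fun_inv hne)
  have hD (u v w : E) : fderiv ℝ (fderiv ℝ κ) y u v w - fderiv ℝ (fderiv ℝ κ) y u w v =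
      2 * (fderiv ℝ γ y u * G y (Complex.I • v) w + γ y * fderiv ℝ G y u (Complex.I • v) w) := by
    have e : (fun z => fderiv ℝ κ z v w - fderiv ℝ κ z w v) =ᶠ[𝓝 y]
        fun z => 2 * (γ z * G z (Complex.I • v) w) := by
      filter_upwards [hn hy] with z hz
      rw [hDκ z hz, mul_assoc]
    have e' : fderiv ℝ (fun z => fderiv ℝ κ z v w - fderiv ℝ κ z w v) y u =
        fderiv ℝ (fun z => 2 * (γ z * G z (Complex.I • v) w)) y u := by rw [e.fderiv_eq]
    rw [fderiv_fun_sub (hdκ' _ _) (hdκ' _ _), sub_apply, fderiv_apply₂ hdκ, fderiv_apply₂ hdκ,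
      fderiv_const_mul (hγ.fun_mul (hdG' (Complex.I • v) w)), fderiv_fun_mul hγ (hdG' _ _)] at e'
    simp only [add_apply, smul_apply, smul_eq_mul, fderiv_apply₂ hdG] at e'
    rw [e']
    ring
  suffices fderiv ℝ γ y = 0 by
    rw [← this]
    exact hγ.hasFDerivAt
  ext u
  rw [zero_apply]
  by_cases hu : u = 0
  · simp [hu]
  -- Two linear conditions on a space of dimension at least 3 leave a nonzero $v$ orthogonal to $u$
  -- and $iu$. Then $(d\gamma\wedge\omega)(u,v,iv)$ reduces to $d\gamma(u)\,G(iv,iv)$.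
  obtain ⟨v, hvk, hv⟩ : ∃ v ∈ LinearMap.ker ((G y u : E →ₗ[ℝ] ℝ).prod
      (G y (Complex.I • u) : E →ₗ[ℝ] ℝ)), v ≠ 0 := by
    apply Submodule.exists_mem_ne_zero_of_ne_bot
    apply LinearMap.ker_ne_bot_of_finrank_lt
    rw [Module.finrank_prod, Module.finrank_self]
    omega
  simp only [LinearMap.mem_ker, LinearMap.prod_apply, Function.prod_apply,
    ContinuousLinearMap.coe_coe, Prod.mk_eq_zero] at hvk
  have c1 := hD u v (Complex.I • v)
  have c2 := hD v (Complex.I • v) u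
  have c3 := hD (Complex.I • v) u v
  have hs (a b c : E) : fderiv ℝ (fderiv ℝ κ) y a b c = fderiv ℝ (fderiv ℝ κ) y b a c := by
    rw [fderiv_fderiv_comm (hκ.contDiffAt (hn hy))]
  have hcl := h.closed y hy u v (Complex.I • v)
  have s1 := hs u v (Complex.I • v)
  have s2 := hs u (Complex.I • v) v
  have s3 := hs v (Complex.I • v) u
  rw [I_smul_I_smul, map_neg, neg_apply, h.symm y hy v u, hvk.1] at c2
  rw [hvk.2] at c3
  rw [I_smul_I_smul] at hcl
  have hp := h.pos y hy _ (hI0 hv)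
  have : fderiv ℝ γ y u * G y (Complex.I • v) (Complex.I • v) = 0 := by
    have hcl' := congrArg (fun r => γ y * r) hcl
    simp only [mul_add, mul_zero] at hcl'
    linarith
  exact (mul_eq_zero.1 this).resolve_right hp.ne'

end LocalMetric

/-! ### Metrics in charts and holomorphic transition maps -/

theorem transition_source_mem_nhds {X Y : Type*} [TopologicalSpace X] [TopologicalSpace Y]
    {φ ψ : OpenPartialHomeomorph X Y} {y : Y} (hy : y ∈ φ.target) (hyψ : φ.symm y ∈ ψ.source) :
    (φ.symm.trans ψ).source ∈ 𝓝 y :=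
  (φ.symm.trans ψ).open_source.mem_nhds (by simp [hy, hyψ])

theorem symm_eventuallyEq_transition {X Y : Type*} [TopologicalSpace X] [TopologicalSpace Y]
    {φ ψ : OpenPartialHomeomorph X Y} {y : Y} (hy : y ∈ φ.target) (hyψ : φ.symm y ∈ ψ.source) :
    (φ.symm : Y → X) =ᶠ[𝓝 y] ψ.symm ∘ (ψ ∘ φ.symm) := by
  filter_upwards [transition_source_mem_nhds hy hyψ] with z hz
  simp only [OpenPartialHomeomorph.trans_source, OpenPartialHomeomorph.symm_source, Set.mem_inter_iff,
    Set.mem_preimage] at hz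
  simp [ψ.left_inv hz.2]

section ChartExpressions

variable {E : Type*} [NormedAddCommGroup E] [NormedSpace ℂ E]
  {M : Type*} [TopologicalSpace M] [ChartedSpace E M] [IsManifold 𝓘(ℂ, E) ∞ M]
  {φ ψ : OpenPartialHomeomorph M E} {y : E}

theorem contMDiffOn_symm_of_mem_atlas (hφ : φ ∈ atlas E M) :
    ContMDiffOn 𝓘(ℝ, E) 𝓘(ℝ, E) ∞ φ.symm φ.target :=
  contMDiffOn_symm_of_mem_maximalAtlas (IsManifold.subset_maximalAtlas hφ)

theorem contDiffOn_comp_symm {f : M → ℝ} (hf : ContMDiff 𝓘(ℝ, E) 𝓘(ℝ, ℝ) ∞ f)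
    (hφ : φ ∈ atlas E M) : ContDiffOn ℝ ∞ (f ∘ φ.symm) φ.target :=
  (hf.comp_contMDiffOn (contMDiffOn_symm_of_mem_atlas hφ)).contDiffOn

theorem contDiffAt_comp_symm {F : M → ℝ} (hF : ContMDiff 𝓘(ℝ, E) 𝓘(ℝ, ℝ) ∞ F) (hφ : φ ∈ atlas E M)
    (hy : y ∈ φ.target) : ContDiffAt ℝ ∞ (F ∘ φ.symm) y :=
  (contDiffOn_comp_symm hF hφ).contDiffAt (φ.open_target.mem_nhds hy)

theorem contDiffOn_complex_transition (hφ : φ ∈ atlas E M) (hψ : ψ ∈ atlas E M) :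
    ContDiffOn ℂ ∞ (ψ ∘ φ.symm) (φ.symm.trans ψ).source := by
  have h := (contDiffGroupoid ∞ 𝓘(ℂ, E)).compatible hφ hψ
  rw [contDiffGroupoid, mem_groupoid_of_pregroupoid] at h
  simpa [contDiffPregroupoid] using h.1

namespace SmoothRiemannianMetric

/-- The metric is a smooth section of a bundle of bilinear forms, here evaluated on the fields
$d\varphi^{-1}(u)$, which are smooth because the tangent map of $\varphi^{-1}$ is. -/
theorem contDiffOn_inChart_apply (g : SmoothRiemannianMetric E M) (hφ : φ ∈ atlas E M) (u v : E) :
    ContDiffOn ℝ ∞ (fun y => g.inChart φ y u v) φ.target := by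
  have hvec (u : E) : ContMDiffOn 𝓘(ℝ, E) (𝓘(ℝ, E).prod 𝓘(ℝ, E)) ∞
      (fun y : E => Bundle.TotalSpace.mk' E (E := fun x : M => TangentSpace 𝓘(ℝ, E) x) (φ.symm y)
        (mfderiv 𝓘(ℝ, E) 𝓘(ℝ, E) φ.symm y u)) φ.target := by
    have h1 := (contMDiffOn_symm_of_mem_atlas (M := M) hφ).contMDiffOn_tangentMapWithin
      (m := ∞) (by simp) φ.open_target.uniqueMDiffOn
    have h2 : ContMDiffOn 𝓘(ℝ, E) (𝓘(ℝ, E).prod 𝓘(ℝ, E)) ∞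
        (fun y : E => (⟨y, u⟩ : TangentBundle 𝓘(ℝ, E) E)) φ.target :=
      contMDiffOn_vectorSpace_iff_contDiffOn.2 contDiffOn_const
    refine (h1.comp h2 fun y hy => hy).congr fun y hy => ?_
    simp only [Function.comp_apply, tangentMapWithin]
    rw [mfderivWithin_of_isOpen φ.open_target hy]
  intro y hy
  have h3 : ContMDiffWithinAt 𝓘(ℝ, E) (𝓘(ℝ, E).prod 𝓘(ℝ)) ∞
      (fun y => Bundle.TotalSpace.mk' ℝ (E := Bundle.Trivial M ℝ) (φ.symm y)
        (g.inner (φ.symm y) (mfderiv 𝓘(ℝ, E) 𝓘(ℝ, E) φ.symm y u)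
          (mfderiv 𝓘(ℝ, E) 𝓘(ℝ, E) φ.symm y v))) φ.target y := by
    apply ContMDiffWithinAt.clm_bundle_apply₂ (F₁ := E) (F₂ := E)
    · exact ContMDiffAt.comp_contMDiffWithinAt y g.contMDiff.contMDiffAt
        (contMDiffOn_symm_of_mem_atlas hφ y hy)
    · exact hvec u y hy
    · exact hvec v y hy
  simp only [Bundle.contMDiffWithinAt_totalSpace] at h3
  exact h3.2.contDiffWithinAt

theorem mfderiv_symm_injective (hφ : φ ∈ atlas E M) (hy : y ∈ φ.target) :
    Function.Injective (mfderiv 𝓘(ℝ, E) 𝓘(ℝ, E) φ.symm y) :=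
  (mdifferentiable_of_mem_atlas (I := 𝓘(ℝ, E)) hφ).symm.mfderiv_injective hy

theorem inChart_symm (g : SmoothRiemannianMetric E M) (φ : OpenPartialHomeomorph M E) (y u v : E) :
    g.inChart φ y u v = g.inChart φ y v u := by
  rw [inChart_apply, inChart_apply]
  exact g.symm _ _ _

theorem inChart_pos (g : SmoothRiemannianMetric E M) (hφ : φ ∈ atlas E M) (hy : y ∈ φ.target)
    {v : E} (hv : v ≠ 0) : 0 < g.inChart φ y v v := by
  rw [inChart_apply]
  refine g.pos _ _ fun h0 => hv (mfderiv_symm_injective (M := M) hφ hy ?_)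
  exact h0.trans (map_zero (mfderiv 𝓘(ℝ, E) 𝓘(ℝ, E) φ.symm y)).symm

theorem contDiffOn_inChart [FiniteDimensional ℂ E] (g : SmoothRiemannianMetric E M)
    (hφ : φ ∈ atlas E M) : ContDiffOn ℝ ∞ (g.inChart φ) φ.target := by
  have := FiniteDimensional.complexToReal E
  rw [contDiffOn_clm_apply]
  intro u
  rw [contDiffOn_clm_apply]
  exact fun v => g.contDiffOn_inChart_apply hφ u v

theorem isMetricOn_inChart [FiniteDimensional ℂ E] (g : SmoothRiemannianMetric E M)
    (hφ : φ ∈ atlas E M) : LocalMetric.IsMetricOn (g.inChart φ) φ.target :=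
  ⟨φ.open_target, g.contDiffOn_inChart hφ, fun y _ u v => g.inChart_symm φ y u v,
    fun _ hy _ hv => g.inChart_pos hφ hy hv⟩

theorem IsKahler.isKahlerOn [FiniteDimensional ℂ E] {g : SmoothRiemannianMetric E M}
    (hg : g.IsKahler) (hφ : φ ∈ atlas E M) : LocalMetric.IsKahlerOn (g.inChart φ) φ.target where
  toIsMetricOn := g.isMetricOn_inChart hφ
  herm y hy := (hg φ hφ y hy).1
  closed y hy u v w := by
    have hd := (g.isMetricOn_inChart hφ).differentiableAt hy
    have := (hg φ hφ y hy).2 u v w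
    rwa [LocalMetric.fderiv_apply₂ hd, LocalMetric.fderiv_apply₂ hd,
      LocalMetric.fderiv_apply₂ hd] at this

/-- `Real.log` is $\log|\cdot|$, so the exponential form $e^{-2\sigma}g$ is available whatever the
sign of $\theta$. -/
theorem inChart_conformal {g ghat : SmoothRiemannianMetric E M} {θ : M → ℝ}
    (hθ_ne : ∀ x, θ x ≠ 0)
    (hconf : ∀ (x : M) (v w : TangentSpace 𝓘(ℝ, E) x),
      ghat.inner x v w = g.inner x v w / θ x ^ 2) (φ : OpenPartialHomeomorph M E) (y : E) :
    ghat.inChart φ y = Real.exp (-2 * Real.log (θ (φ.symm y))) • g.inChart φ y := by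
  ext u v
  have e : Real.exp (-2 * Real.log (θ (φ.symm y))) = (θ (φ.symm y) ^ 2)⁻¹ := by
    rw [show -2 * Real.log (θ (φ.symm y)) = -(Real.log (θ (φ.symm y) ^ 2)) by
      rw [Real.log_pow]; push_cast; ring, Real.exp_neg, Real.exp_log]
    exact sq_pos_of_ne_zero (hθ_ne _)
  rw [e, inChart_apply, hconf, smul_apply, smul_apply, inChart_apply, smul_eq_mul,
    div_eq_inv_mul]

end SmoothRiemannianMetric

section Transition

theorem contDiffAt_transition (hφ : φ ∈ atlas E M) (hψ : ψ ∈ atlas E M) (hy : y ∈ φ.target)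
    (hyψ : φ.symm y ∈ ψ.source) : ContDiffAt ℝ ∞ (ψ ∘ φ.symm) y :=
  ((contDiffOn_complex_transition hφ hψ).contDiffAt
    (transition_source_mem_nhds hy hyψ)).restrict_scalars ℝ

theorem fderiv_transition_I (hφ : φ ∈ atlas E M) (hψ : ψ ∈ atlas E M) (hy : y ∈ φ.target)
    (hyψ : φ.symm y ∈ ψ.source) (v : E) :
    fderiv ℝ (ψ ∘ φ.symm) y (Complex.I • v) = Complex.I • fderiv ℝ (ψ ∘ φ.symm) y v := by
  have h : DifferentiableAt ℂ (ψ ∘ φ.symm) y :=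
    ((contDiffOn_complex_transition hφ hψ).contDiffAt
      (transition_source_mem_nhds hy hyψ)).differentiableAt (by simp)
  rw [h.fderiv_restrictScalars ℝ]
  simp

/-- The second derivative of a holomorphic map is complex bilinear. -/
theorem fderiv_fderiv_transition_I_I (hφ : φ ∈ atlas E M) (hψ : ψ ∈ atlas E M) (hy : y ∈ φ.target)
    (hyψ : φ.symm y ∈ ψ.source) (u v : E) :
    fderiv ℝ (fderiv ℝ (ψ ∘ φ.symm)) y (Complex.I • u) (Complex.I • v) =
      - fderiv ℝ (fderiv ℝ (ψ ∘ φ.symm)) y u v := by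
  have hs := contDiffAt_transition hφ hψ hy hyψ
  have hd : DifferentiableAt ℝ (fderiv ℝ (ψ ∘ φ.symm)) y :=
    (hs.fderiv_right (m := ∞) (by simp)).differentiableAt (by simp)
  have key (a b : E) : fderiv ℝ (fderiv ℝ (ψ ∘ φ.symm)) y a (Complex.I • b) =
      Complex.I • fderiv ℝ (fderiv ℝ (ψ ∘ φ.symm)) y a b := by
    have e : (fun z => fderiv ℝ (ψ ∘ φ.symm) z (Complex.I • b)) =ᶠ[𝓝 y]
        fun z => LocalMetric.complexJ E (fderiv ℝ (ψ ∘ φ.symm) z b) := by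
      filter_upwards [transition_source_mem_nhds hy hyψ] with z hz
      simp only [OpenPartialHomeomorph.trans_source, OpenPartialHomeomorph.symm_source,
        Set.mem_inter_iff, Set.mem_preimage] at hz
      exact fderiv_transition_I hφ hψ hz.1 hz.2 b
    rw [← LocalMetric.fderiv_apply hd, ← LocalMetric.fderiv_apply hd, e.fderiv_eq]
    exact congrArg (fun L : E →L[ℝ] E => L a) ((LocalMetric.complexJ E).hasFDerivAt.comp y
      (LocalMetric.hasFDerivAt_apply hd b)).fderiv |>.trans
      (by rw [LocalMetric.fderiv_apply hd]; rfl)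
  rw [key, LocalMetric.fderiv_fderiv_comm hs, key, LocalMetric.I_smul_I_smul,
    LocalMetric.fderiv_fderiv_comm hs]

theorem inChart_transition (g : SmoothRiemannianMetric E M) (hφ : φ ∈ atlas E M)
    (hψ : ψ ∈ atlas E M) (hy : y ∈ φ.target) (hyψ : φ.symm y ∈ ψ.source) (u v : E) :
    g.inChart φ y u v = g.inChart ψ (ψ (φ.symm y)) (fderiv ℝ (ψ ∘ φ.symm) y u)
      (fderiv ℝ (ψ ∘ φ.symm) y v) := by
  have hs := (contDiffAt_transition hφ hψ hy hyψ).differentiableAt (by simp)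
  have e := (symm_eventuallyEq_transition hy hyψ).mfderiv_eq (I := 𝓘(ℝ, E)) (I' := 𝓘(ℝ, E))
  have hψs : MDifferentiableAt 𝓘(ℝ, E) 𝓘(ℝ, E) ψ.symm ((ψ ∘ φ.symm) y) :=
    (mdifferentiable_of_mem_atlas (I := 𝓘(ℝ, E)) hψ).mdifferentiableAt_symm (ψ.map_source hyψ)
  have c := mfderiv_comp y hψs hs.mdifferentiableAt
  have hx : ψ.symm (ψ (φ.symm y)) = φ.symm y := ψ.left_inv hyψ
  have key (a : E) : (mfderiv 𝓘(ℝ, E) 𝓘(ℝ, E) φ.symm y a : E) =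
      (mfderiv 𝓘(ℝ, E) 𝓘(ℝ, E) ψ.symm (ψ (φ.symm y)) (fderiv ℝ (ψ ∘ φ.symm) y a) : E) := by
    rw [← mfderiv_eq_fderiv]
    have := congrArg (fun L : E →L[ℝ] E => L a) (e.trans c)
    exact this
  -- The two base points are only propositionally equal, so the inner products are compared after
  -- viewing every tangent space as $E$.
  have hin (p q : M) (hpq : p = q) (a b : E) : (g.inner p : E →L[ℝ] E →L[ℝ] ℝ) a b =
      (g.inner q : E →L[ℝ] E →L[ℝ] ℝ) a b := by subst hpq; rfl
  refine (SmoothRiemannianMetric.inChart_apply g φ y u v).trans ?_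
  refine Eq.trans ?_ (SmoothRiemannianMetric.inChart_apply g ψ _ _ _).symm
  refine Eq.trans ?_ (hin _ _ hx _ _).symm
  exact congrArg₂ (fun a b : E => (g.inner (φ.symm y) : E →L[ℝ] E →L[ℝ] ℝ) a b) (key u) (key v)

end Transition

end ChartExpressions

/-! ### The linear equation for the conformal factor -/

namespace LocalMetric

section ChainRule

variable {E : Type*} [NormedAddCommGroup E] [NormedSpace ℝ E] {f : E → ℝ} {W : ℝ → ℝ} {y : E}

theorem fderiv_comp_real (hW : DifferentiableAt ℝ W (f y)) (hf : DifferentiableAt ℝ f y) (u : E) :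
    fderiv ℝ (W ∘ f) y u = deriv W (f y) * fderiv ℝ f y u := by
  have := (hW.hasDerivAt.comp_hasFDerivAt y hf.hasFDerivAt).fderiv
  rw [this]; rfl

theorem fderiv_fderiv_comp_real (hW : ContDiffAt ℝ ∞ W (f y)) (hf : ContDiffAt ℝ ∞ f y) (u v : E) :
    fderiv ℝ (fderiv ℝ (W ∘ f)) y u v =
      deriv (deriv W) (f y) * (fderiv ℝ f y u * fderiv ℝ f y v)
        + deriv W (f y) * fderiv ℝ (fderiv ℝ f) y u v := by
  have hd := hf.differentiableAt (by simp)
  have hWd := hW.differentiableAt (by simp)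
  have hd2 : DifferentiableAt ℝ (fderiv ℝ f) y :=
    (hf.fderiv_right (m := ∞) (by simp)).differentiableAt (by simp)
  have hWd2 : DifferentiableAt ℝ (deriv W) (f y) :=
    ((hW.fderiv_right (m := ∞) (by simp)).differentiableAt (by simp)).clm_apply
      (differentiableAt_const 1)
  have hc2 : DifferentiableAt ℝ (fderiv ℝ (W ∘ f)) y :=
    ((hW.comp y hf).fderiv_right (m := ∞) (by simp)).differentiableAt (by simp)
  have e : (fun z => fderiv ℝ (W ∘ f) z v) =ᶠ[𝓝 y]
      fun z => (deriv W ∘ f) z * fderiv ℝ f z v := by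
    have h1 : ∀ᶠ z in 𝓝 y, ContDiffAt ℝ 1 f z :=
      (hf.of_le (m := 1) (by simp)).eventually (by simp)
    have h2 : ∀ᶠ z in 𝓝 y, ContDiffAt ℝ 1 W (f z) :=
      hf.continuousAt.eventually ((hW.of_le (m := 1) (by simp)).eventually (by simp))
    filter_upwards [h1, h2] with z hz hz'
    exact fderiv_comp_real (hz'.differentiableAt (by simp)) (hz.differentiableAt (by simp)) v
  rw [← fderiv_apply hc2, e.fderiv_eq,
    fderiv_fun_mul (hWd2.comp y hd) (hasFDerivAt_apply hd2 v).differentiableAt, add_apply,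
    smul_apply, smul_apply, fderiv_comp_real hWd2 hd, fderiv_apply hd2]
  simp only [smul_eq_mul, Function.comp_apply]
  ring

theorem hessian_const_mul (G : E → E →L[ℝ] E →L[ℝ] ℝ) (hf : ContDiffAt ℝ ∞ f y) (a : ℝ) (u v : E) :
    hessian G (fun z => a * f z) y u v = a * hessian G f y u v := by
  have h1 : DifferentiableAt ℝ (fun t : ℝ => a * t) (f y) := by fun_prop
  have h2 : ContDiffAt ℝ ∞ (fun t : ℝ => a * t) (f y) := by fun_prop
  have e : (fun z => a * f z) = (fun t : ℝ => a * t) ∘ f := rfl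
  have e1 : deriv (fun t : ℝ => a * t) = fun _ => a := by
    ext t
    simp
  rw [hessian, hessian, e, fderiv_fderiv_comp_real h2 hf,
    fderiv_comp_real h1 (hf.differentiableAt (by simp)), e1]
  simp
  ring

end ChainRule

variable {E : Type*} [NormedAddCommGroup E] [NormedSpace ℂ E]
  {G Ghat : E → E →L[ℝ] E →L[ℝ] ℝ} {U : Set E} {y : E} {σ f c θ : E → ℝ}

/-- The endomorphism-valued coefficient in the linear equation satisfied by `θ`. -/
def solitonCoefficient (G : E → E →L[ℝ] E →L[ℝ] ℝ) (f : E → ℝ) (y : E) : E →L[ℝ] E →L[ℝ] E :=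
  let Q : E →L[ℝ] E →L[ℝ] E := (fderiv ℝ f y).smulRight (ContinuousLinearMap.id ℝ E)
  let R : E →L[ℝ] E →L[ℝ] E := (fderiv ℝ f y ∘L complexJ E).smulRight (complexJ E)
  (2 : ℝ) • christoffel G y - ((Module.finrank ℝ E : ℝ) - 2)⁻¹ • (Q + Q.flip - R - R.flip)

theorem solitonCoefficient_apply (G : E → E →L[ℝ] E →L[ℝ] ℝ) (f : E → ℝ) (y u v : E) :
    solitonCoefficient G f y u v = (2 : ℝ) • christoffel G y u v
      - ((Module.finrank ℝ E : ℝ) - 2)⁻¹ • (fderiv ℝ f y u • v + fderiv ℝ f y v • u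
        - fderiv ℝ f y (Complex.I • u) • Complex.I • v
        - fderiv ℝ f y (Complex.I • v) • Complex.I • u) := rfl

/-- A solution of `D²w(u, v) - D²w(iu, iv) = dw(P(u, v))` which is a function `W` of `f` near
`y`, with `W` vanishing to second order at `f y`, has vanishing second derivative at `y`. -/
theorem jet_eq_zero_of_eventuallyEq_comp {w : E → ℝ} {W : ℝ → ℝ} {P : E →L[ℝ] E →L[ℝ] E}
    (hW : ContDiff ℝ ∞ W) (hf : ContDiffAt ℝ ∞ f y) (hw : w =ᶠ[𝓝 y] W ∘ f)
    (hW1 : deriv W (f y) = 0)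
    (heq : ∀ u v, fderiv ℝ (fderiv ℝ w) y u v
      - fderiv ℝ (fderiv ℝ w) y (Complex.I • u) (Complex.I • v) = fderiv ℝ w y (P u v)) :
    fderiv ℝ w y = 0 ∧ fderiv ℝ (fderiv ℝ w) y = 0 := by
  have d1 : fderiv ℝ w y = 0 := by
    ext u
    rw [hw.fderiv_eq, fderiv_comp_real (hW.differentiable (by simp) _)
      (hf.differentiableAt (by simp)), hW1, zero_mul, zero_apply]
  have d2 (u v : E) : fderiv ℝ (fderiv ℝ w) y u v =
      deriv (deriv W) (f y) * (fderiv ℝ f y u * fderiv ℝ f y v) := by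
    rw [hw.fderiv.fderiv_eq, fderiv_fderiv_comp_real hW.contDiffAt hf, hW1, zero_mul, add_zero]
  refine ⟨d1, ?_⟩
  ext u v
  rw [d2, zero_apply, zero_apply]
  by_cases hu : fderiv ℝ f y u = 0
  · rw [hu, zero_mul, mul_zero]
  suffices deriv (deriv W) (f y) = 0 by rw [this, zero_mul]
  -- Here $dw=0$ and $D^2w=W''\,df\otimes df$. If $W''\ne0$, the pairs $(u,u)$ and $(u,iu)$ give
  -- $df(u)^2=df(iu)^2$ and $df(u)\,df(iu)=0$, hence $df(u)=0$.
  have e1 := heq u u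
  have e2 := heq u (Complex.I • u)
  rw [d2, d2, d1, zero_apply, ← mul_sub] at e1 e2
  rw [I_smul_I_smul, map_neg] at e2
  by_contra hne
  have f1 := (mul_eq_zero.1 e1).resolve_left hne
  have f2 := (mul_eq_zero.1 e2).resolve_left hne
  have f3 : fderiv ℝ f y (Complex.I • u) = 0 := by
    apply (mul_eq_zero.1 (_ : fderiv ℝ f y u * fderiv ℝ f y (Complex.I • u) = 0)).resolve_left hu
    linarith
  rw [f3] at f1
  exact hu (mul_self_eq_zero.1 (by linarith))

variable [FiniteDimensional ℂ E]

/-- The almost soliton equation for `exp (-2σ) G`, as an equation for `G`. -/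
theorem IsMetricOn.ricci_add_of_conformal (h : IsMetricOn G U) (hhat : IsMetricOn Ghat U)
    (hσ : ContDiffOn ℝ ∞ σ U) (hc : ∀ z ∈ U, Ghat z = Real.exp (-2 * σ z) • G z)
    (heq : ∀ y ∈ U, ∀ v w, ricci Ghat y v w + hessian Ghat f y v w = c y * Ghat y v w)
    (hy : y ∈ U) (v w : E) :
    ricci G y v w + ((Module.finrank ℝ E : ℝ) - 2) *
        (hessian G σ y v w + fderiv ℝ σ y v * fderiv ℝ σ y w)
      + hessian G f y v w + fderiv ℝ σ y v * fderiv ℝ f y w + fderiv ℝ σ y w * fderiv ℝ f y v =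
    (c y * Real.exp (-2 * σ y) - laplacian G σ y
      + ((Module.finrank ℝ E : ℝ) - 2) * fderiv ℝ σ y (gradient G σ y)
      + fderiv ℝ f y (gradient G σ y)) * G y v w := by
  have := FiniteDimensional.complexToReal E
  have e := heq y hy v w
  rw [h.ricci_conformal hhat hσ hc hy, h.hessian_conformal hhat hσ hc hy, hc y hy, smul_apply,
    smul_apply, smul_eq_mul] at e
  linarith

theorem IsMetricOn.contDiffOn_solitonCoefficient (h : IsMetricOn G U) (hf : ContDiffOn ℝ ∞ f U) :
    ContDiffOn ℝ ∞ (solitonCoefficient G f) U := by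
  have := FiniteDimensional.complexToReal E
  have hf1 : ContDiffOn ℝ ∞ (fderiv ℝ f) U := hf.fderiv_of_isOpen h.isOpen (by simp)
  have hfa (a b : E) : ContDiffOn ℝ ∞ (fun z => fderiv ℝ f z a • b) U :=
    (hf1.clm_apply contDiffOn_const).smul contDiffOn_const
  rw [contDiffOn_clm_apply]
  intro u
  rw [contDiffOn_clm_apply]
  intro v
  simp only [solitonCoefficient_apply]
  exact (((h.contDiffOn_christoffel.clm_apply contDiffOn_const).clm_apply
    contDiffOn_const).const_smul _).sub
    (((((hfa u v).add (hfa v u)).sub (hfa _ _)).sub (hfa _ _)).const_smul _)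

/-- If `θ⁻² G` is an almost soliton with Killing potential `f`, then
`(n - 2) ∇dθ + dθ ⊗ df + df ⊗ dθ` is hermitian. -/
theorem IsKahlerOn.conformal_factor_hermitian (h : IsKahlerOn G U) (hhat : IsMetricOn Ghat U)
    (hθ : ContDiffOn ℝ ∞ θ U) (hθ_ne : ∀ z ∈ U, θ z ≠ 0)
    (hc : ∀ z ∈ U, Ghat z = Real.exp (-2 * Real.log (θ z)) • G z)
    (heq : ∀ y ∈ U, ∀ v w, ricci Ghat y v w + hessian Ghat f y v w = c y * Ghat y v w)
    (hherm : ∀ y ∈ U, ∀ v w,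
      hessian G f y (Complex.I • v) (Complex.I • w) = hessian G f y v w)
    (hy : y ∈ U) (v w : E) :
    ((Module.finrank ℝ E : ℝ) - 2) * hessian G θ y (Complex.I • v) (Complex.I • w)
      + fderiv ℝ θ y (Complex.I • v) * fderiv ℝ f y (Complex.I • w)
      + fderiv ℝ θ y (Complex.I • w) * fderiv ℝ f y (Complex.I • v) =
    ((Module.finrank ℝ E : ℝ) - 2) * hessian G θ y v w
      + fderiv ℝ θ y v * fderiv ℝ f y w + fderiv ℝ θ y w * fderiv ℝ f y v := by
  have hne := hθ_ne y hy
  have hσ : ContDiffOn ℝ ∞ (Real.log ∘ θ) U := hθ.log hθ_ne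
  have hθy := hθ.contDiffAt (h.isOpen.mem_nhds hy)
  have hlog : ContDiffAt ℝ ∞ Real.log (θ y) := Real.contDiffAt_log.2 hne
  have d1 (u : E) : fderiv ℝ (Real.log ∘ θ) y u = (θ y)⁻¹ * fderiv ℝ θ y u := by
    rw [fderiv_comp_real (hlog.differentiableAt (by simp)) (hθy.differentiableAt (by simp)),
      Real.deriv_log]
  -- Thus $\nabla d\sigma+d\sigma\otimes d\sigma=\theta^{-1}\nabla d\theta$: passing from $\sigma$
  -- to $\theta$ removes the quadratic term and makes the condition linear.
  have d2 (u v : E) : hessian G (Real.log ∘ θ) y u v = (θ y)⁻¹ * hessian G θ y u v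
      - (θ y)⁻¹ * fderiv ℝ θ y u * ((θ y)⁻¹ * fderiv ℝ θ y v) := by
    rw [hessian, fderiv_fderiv_comp_real hlog hθy, d1, Real.deriv_log', deriv_inv, hessian]
    field_simp
    ring
  have e1 := h.ricci_add_of_conformal hhat hσ hc heq hy v w
  have e2 := h.ricci_add_of_conformal hhat hσ hc heq hy (Complex.I • v) (Complex.I • w)
  rw [h.ricci_I_I hy, hherm y hy, h.herm y hy, ← e1] at e2
  simp only [d1, d2] at e2
  have hi : (θ y)⁻¹ * θ y = 1 := inv_mul_cancel₀ hne
  have hi' : (θ y)⁻¹ ≠ 0 := inv_ne_zero hne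
  apply mul_left_cancel₀ hi'
  linarith

/-- The equation satisfied by the difference of `θ` and `exp (-2f / (n - 2))`. -/
theorem IsKahlerOn.conformal_factor_sub_exp (h : IsKahlerOn G U) (hhat : IsMetricOn Ghat U)
    (hdim : 3 ≤ Module.finrank ℝ E)
    (hθ : ContDiffOn ℝ ∞ θ U) (hf : ContDiffOn ℝ ∞ f U) (hθ_ne : ∀ z ∈ U, θ z ≠ 0)
    (hc : ∀ z ∈ U, Ghat z = Real.exp (-2 * Real.log (θ z)) • G z)
    (heq : ∀ y ∈ U, ∀ v w, ricci Ghat y v w + hessian Ghat f y v w = c y * Ghat y v w)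
    (hherm : ∀ y ∈ U, ∀ v w,
      hessian G f y (Complex.I • v) (Complex.I • w) = hessian G f y v w)
    (hy : y ∈ U) (u v : E) :
    fderiv ℝ (fderiv ℝ fun z => θ z - Real.exp (-2 * f z / ((Module.finrank ℝ E : ℝ) - 2))) y u v
      - fderiv ℝ (fderiv ℝ fun z => θ z - Real.exp (-2 * f z / ((Module.finrank ℝ E : ℝ) - 2))) y
        (Complex.I • u) (Complex.I • v) =
    fderiv ℝ (fun z => θ z - Real.exp (-2 * f z / ((Module.finrank ℝ E : ℝ) - 2))) y
      (solitonCoefficient G f y u v) := by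
  set m : ℝ := (Module.finrank ℝ E : ℝ) - 2 with hm
  have hm0 : m ≠ 0 := by
    have : (3 : ℝ) ≤ Module.finrank ℝ E := by exact_mod_cast hdim
    rw [hm]; linarith
  set W : ℝ → ℝ := fun t => Real.exp (-2 * t / m) with hW
  have hWs : ContDiff ℝ ∞ W := by fun_prop
  have hW1 : deriv W = fun t => (-2 / m) * W t := by
    ext t
    have h1 : HasDerivAt (fun t : ℝ => -2 * t / m) (-2 * 1 / m) t :=
      ((hasDerivAt_id t).const_mul (-2)).div_const m
    rw [h1.exp.deriv]
    simp only [hW]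
    ring
  have hW2 : deriv (deriv W) = fun t => (-2 / m) * ((-2 / m) * W t) := by
    ext t
    rw [hW1, deriv_const_mul _ (hWs.differentiable (by simp) t), hW1]
  have hn {z : E} (hz : z ∈ U) := h.isOpen.mem_nhds hz
  have hfy := hf.contDiffAt (hn hy)
  have hθ1 : ContDiffOn ℝ ∞ (fderiv ℝ θ) U := hθ.fderiv_of_isOpen h.isOpen (by simp)
  have hψ : ContDiffOn ℝ ∞ (W ∘ f) U := hWs.comp_contDiffOn hf
  have hψ1 : ContDiffOn ℝ ∞ (fderiv ℝ (W ∘ f)) U := hψ.fderiv_of_isOpen h.isOpen (by simp)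
  have dd {F : E → ℝ} (hF : ContDiffOn ℝ ∞ F U) {z : E} (hz : z ∈ U) : DifferentiableAt ℝ F z :=
    (hF.contDiffAt (hn hz)).differentiableAt (by simp)
  have dd1 {F : E → E →L[ℝ] ℝ} (hF : ContDiffOn ℝ ∞ F U) {z : E} (hz : z ∈ U) :
      DifferentiableAt ℝ F z :=
    (hF.contDiffAt (hn hz)).differentiableAt (by simp)
  have e1 : fderiv ℝ (fun z => θ z - W (f z)) =ᶠ[𝓝 y]
      fun z => fderiv ℝ θ z - fderiv ℝ (W ∘ f) z := by
    filter_upwards [hn hy] with z hz using fderiv_fun_sub (dd hθ hz) (dd hψ hz)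
  have w1 (a : E) : fderiv ℝ (fun z => θ z - W (f z)) y a =
      fderiv ℝ θ y a - (-2 / m) * W (f y) * fderiv ℝ f y a := by
    rw [e1.eq_of_nhds, sub_apply, fderiv_comp_real (hWs.differentiable (by simp) _)
      (dd hf hy), hW1]
  have w2 (a b : E) : fderiv ℝ (fderiv ℝ (fun z => θ z - W (f z))) y a b =
      fderiv ℝ (fderiv ℝ θ) y a b
        - ((-2 / m) * ((-2 / m) * W (f y)) * (fderiv ℝ f y a * fderiv ℝ f y b)
          + (-2 / m) * W (f y) * fderiv ℝ (fderiv ℝ f) y a b) := by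
    rw [e1.fderiv_eq, fderiv_fun_sub (dd1 hθ1 hy) (dd1 hψ1 hy), sub_apply, sub_apply,
      fderiv_fderiv_comp_real hWs.contDiffAt hfy, hW2, hW1]
  have E1 := h.conformal_factor_hermitian hhat hθ hθ_ne hc heq hherm hy u v
  have E2 := hherm y hy u v
  rw [w2, w2, w1, solitonCoefficient_apply]
  simp only [hessian, h.christoffel_I_left hy, h.christoffel_I_right hy, I_smul_I_smul, map_neg,
    ← hm] at E1 E2
  simp only [map_sub, map_add, map_smul, smul_eq_mul, ← hm]
  field_simp
  -- `E1` treats $\theta$. For $W\circ f$ the $df\otimes df$ terms cancel through $mW''+2W'=0$, and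
  -- what remains is a multiple of the hermitian identity `E2` for $\nabla df$.
  linear_combination (-m) * E1 + (-2 * m * W (f y)) * E2

end LocalMetric

/-! ### From charts to the manifold: constancy and coordinate invariance -/

theorem comp_symm_eventuallyEq_transition {X Y : Type*} [TopologicalSpace X] [TopologicalSpace Y]
    {φ ψ : OpenPartialHomeomorph X Y} {y : Y} (F : X → ℝ) (hy : y ∈ φ.target)
    (hyψ : φ.symm y ∈ ψ.source) :
    F ∘ φ.symm =ᶠ[𝓝 y] (F ∘ ψ.symm) ∘ (ψ ∘ φ.symm) :=
  (symm_eventuallyEq_transition hy hyψ).fun_comp F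

section Constant

variable {E : Type*} [NormedAddCommGroup E] [NormedSpace ℝ E]
  {M : Type*} [TopologicalSpace M] [ChartedSpace E M]

/-- A function on a connected manifold with vanishing derivative in every chart is constant. -/
theorem eq_of_forall_hasFDerivAt_zero [ConnectedSpace M] {γ : M → ℝ}
    (h : ∀ φ ∈ atlas E M, ∀ y ∈ φ.target, HasFDerivAt (γ ∘ φ.symm) (0 : E →L[ℝ] ℝ) y) (x y : M) :
    γ x = γ y := by
  refine IsLocallyConstant.apply_eq_of_preconnectedSpace ?_ x y
  rw [IsLocallyConstant.iff_exists_open]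
  intro p
  set φ := chartAt E p
  have hφ : φ ∈ atlas E M := chart_mem_atlas E p
  obtain ⟨r, hr, hball⟩ := Metric.isOpen_iff.1 φ.open_target (φ p) (mem_chart_target E p)
  refine ⟨φ.source ∩ φ ⁻¹' Metric.ball (φ p) r, φ.isOpen_inter_preimage Metric.isOpen_ball,
    ⟨mem_chart_source E p, Metric.mem_ball_self hr⟩, ?_⟩
  rintro x ⟨hx, hxb⟩
  have := Metric.isOpen_ball.is_const_of_fderiv_eq_zero (𝕜 := ℝ)
    (convex_ball (φ p) r).isPreconnected
    (fun z hz => (h φ hφ z (hball hz)).differentiableAt.differentiableWithinAt)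
    (fun z hz => (h φ hφ z (hball hz)).fderiv) hxb (Metric.mem_ball_self hr)
  simpa [φ.left_inv hx, φ.left_inv (mem_chart_source E p)] using this

end Constant

section Invariance

variable {E : Type*} [NormedAddCommGroup E] [NormedSpace ℂ E]
  {M : Type*} [TopologicalSpace M] [ChartedSpace E M] [IsManifold 𝓘(ℂ, E) ∞ M]
  {φ ψ : OpenPartialHomeomorph M E} {y : E} {g : SmoothRiemannianMetric E M} {F : M → ℝ}

open LocalMetric

theorem fderiv_comp_symm_transition (hF : ContMDiff 𝓘(ℝ, E) 𝓘(ℝ, ℝ) ∞ F) (hφ : φ ∈ atlas E M)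
    (hψ : ψ ∈ atlas E M) (hy : y ∈ φ.target) (hyψ : φ.symm y ∈ ψ.source) (u : E) :
    fderiv ℝ (F ∘ φ.symm) y u =
      fderiv ℝ (F ∘ ψ.symm) (ψ (φ.symm y)) (fderiv ℝ (ψ ∘ φ.symm) y u) := by
  have hs := (contDiffAt_transition hφ hψ hy hyψ).differentiableAt (by simp)
  have hd : DifferentiableAt ℝ (F ∘ ψ.symm) ((ψ ∘ φ.symm) y) :=
    (contDiffAt_comp_symm hF hψ (ψ.map_source hyψ)).differentiableAt (by simp)
  rw [(comp_symm_eventuallyEq_transition F hy hyψ).fderiv_eq, fderiv_comp y hd hs]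
  rfl

/-- The sum `D²F(u, v) + D²F(iu, iv)` is invariant under holomorphic coordinate changes. -/
theorem fderiv_fderiv_add_transition (hF : ContMDiff 𝓘(ℝ, E) 𝓘(ℝ, ℝ) ∞ F) (hφ : φ ∈ atlas E M)
    (hψ : ψ ∈ atlas E M) (hy : y ∈ φ.target) (hyψ : φ.symm y ∈ ψ.source) (u v : E) :
    fderiv ℝ (fderiv ℝ (F ∘ φ.symm)) y u v
        + fderiv ℝ (fderiv ℝ (F ∘ φ.symm)) y (Complex.I • u) (Complex.I • v) =
      fderiv ℝ (fderiv ℝ (F ∘ ψ.symm)) (ψ (φ.symm y)) (fderiv ℝ (ψ ∘ φ.symm) y u)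
          (fderiv ℝ (ψ ∘ φ.symm) y v)
        + fderiv ℝ (fderiv ℝ (F ∘ ψ.symm)) (ψ (φ.symm y))
          (Complex.I • fderiv ℝ (ψ ∘ φ.symm) y u) (Complex.I • fderiv ℝ (ψ ∘ φ.symm) y v) := by
  have hs := contDiffAt_transition hφ hψ hy hyψ
  have hsd := hs.differentiableAt (by simp)
  have hs1 : DifferentiableAt ℝ (fderiv ℝ (ψ ∘ φ.symm)) y :=
    (hs.fderiv_right (m := ∞) (by simp)).differentiableAt (by simp)
  have hF1 : DifferentiableAt ℝ (fderiv ℝ (F ∘ φ.symm)) y :=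
    ((contDiffAt_comp_symm hF hφ hy).fderiv_right (m := ∞) (by simp)).differentiableAt (by simp)
  have hFψ1 : DifferentiableAt ℝ (fderiv ℝ (F ∘ ψ.symm)) ((ψ ∘ φ.symm) y) :=
    ((contDiffAt_comp_symm hF hψ (ψ.map_source hyψ)).fderiv_right
      (m := ∞) (by simp)).differentiableAt (by simp)
  have key (a b : E) : fderiv ℝ (fderiv ℝ (F ∘ φ.symm)) y a b =
      fderiv ℝ (fderiv ℝ (F ∘ ψ.symm)) (ψ (φ.symm y)) (fderiv ℝ (ψ ∘ φ.symm) y a)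
          (fderiv ℝ (ψ ∘ φ.symm) y b)
        + fderiv ℝ (F ∘ ψ.symm) (ψ (φ.symm y)) (fderiv ℝ (fderiv ℝ (ψ ∘ φ.symm)) y a b) := by
    have e : (fun z => fderiv ℝ (F ∘ φ.symm) z b) =ᶠ[𝓝 y]
        fun z => (fderiv ℝ (F ∘ ψ.symm) ∘ (ψ ∘ φ.symm)) z (fderiv ℝ (ψ ∘ φ.symm) z b) := by
      filter_upwards [transition_source_mem_nhds hy hyψ] with z hz
      simp only [OpenPartialHomeomorph.trans_source, OpenPartialHomeomorph.symm_source,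
        Set.mem_inter_iff, Set.mem_preimage] at hz
      exact fderiv_comp_symm_transition hF hφ hψ hz.1 hz.2 b
    rw [← fderiv_apply hF1, e.fderiv_eq, fderiv_clm_apply' (hFψ1.comp y hsd)
      (hasFDerivAt_apply hs1 b).differentiableAt, fderiv_comp y hFψ1 hsd, fderiv_apply hs1]
    rfl
  rw [key, key, fderiv_fderiv_transition_I_I hφ hψ hy hyψ, fderiv_transition_I hφ hψ hy hyψ,
    fderiv_transition_I hφ hψ hy hyψ, map_neg]
  ring

variable [FiniteDimensional ℂ E]

theorem gradient_transition (hF : ContMDiff 𝓘(ℝ, E) 𝓘(ℝ, ℝ) ∞ F) (hφ : φ ∈ atlas E M)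
    (hψ : ψ ∈ atlas E M) (hy : y ∈ φ.target) (hyψ : φ.symm y ∈ ψ.source)
    (hsurj : Function.Surjective (fderiv ℝ (ψ ∘ φ.symm) y)) :
    fderiv ℝ (ψ ∘ φ.symm) y (gradient (g.inChart φ) (F ∘ φ.symm) y) =
      gradient (g.inChart ψ) (F ∘ ψ.symm) (ψ (φ.symm y)) := by
  refine (g.isMetricOn_inChart hψ).ext (ψ.map_source hyψ) fun w => ?_
  obtain ⟨v, rfl⟩ := hsurj w
  rw [← inChart_transition g hφ hψ hy hyψ, (g.isMetricOn_inChart hφ).apply_gradient hy,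
    (g.isMetricOn_inChart hψ).apply_gradient (ψ.map_source hyψ),
    fderiv_comp_symm_transition hF hφ hψ hy hyψ]

/-- $\Gamma(iu,iv)=-\Gamma(u,v)$, so the connection cancels in the $J$-average. A hermitian Hessian
can then be compared between charts without the transformation law of the Christoffel symbols. -/
theorem LocalMetric.IsKahlerOn.two_mul_hessian {G : E → E →L[ℝ] E →L[ℝ] ℝ} {U : Set E} {f : E → ℝ}
    (h : IsKahlerOn G U) (hy : y ∈ U)
    (hherm : ∀ v w, hessian G f y (Complex.I • v) (Complex.I • w) = hessian G f y v w) (u v : E) :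
    2 * hessian G f y u v = fderiv ℝ (fderiv ℝ f) y u v
      + fderiv ℝ (fderiv ℝ f) y (Complex.I • u) (Complex.I • v) := by
  have := hherm u v
  simp only [hessian, h.christoffel_I_left hy, h.christoffel_I_right hy, I_smul_I_smul,
    map_neg] at this ⊢
  linarith

/-- A vector in the kernel would have zero length for $g$; finite dimension gives surjectivity. -/
theorem fderiv_transition_bijective (hφ : φ ∈ atlas E M) (hψ : ψ ∈ atlas E M) (hy : y ∈ φ.target)
    (hyψ : φ.symm y ∈ ψ.source) (g : SmoothRiemannianMetric E M) :
    Function.Bijective (fderiv ℝ (ψ ∘ φ.symm) y) := by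
  have := FiniteDimensional.complexToReal E
  have hinj : Function.Injective (fderiv ℝ (ψ ∘ φ.symm) y : E →ₗ[ℝ] E) := by
    rw [← LinearMap.ker_eq_bot, LinearMap.ker_eq_bot']
    intro v hv
    by_contra hne
    have hp := g.inChart_pos hφ hy hne
    rw [inChart_transition g hφ hψ hy hyψ] at hp
    have hv' : fderiv ℝ (ψ ∘ φ.symm) y v = 0 := hv
    rw [hv'] at hp
    simp at hp
  exact ⟨hinj, LinearMap.surjective_of_injective hinj⟩

/-- The Laplacian of a function with hermitian Hessian does not depend on the chart. -/
theorem laplacian_transition (hg : g.IsKahler) (hF : ContMDiff 𝓘(ℝ, E) 𝓘(ℝ, ℝ) ∞ F)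
    (hherm : ∀ φ ∈ atlas E M, ∀ y ∈ φ.target, ∀ v w,
      hessian (g.inChart φ) (F ∘ φ.symm) y (Complex.I • v) (Complex.I • w) =
        hessian (g.inChart φ) (F ∘ φ.symm) y v w)
    (hφ : φ ∈ atlas E M) (hψ : ψ ∈ atlas E M) (hy : y ∈ φ.target) (hyψ : φ.symm y ∈ ψ.source) :
    laplacian (g.inChart φ) (F ∘ φ.symm) y =
      laplacian (g.inChart ψ) (F ∘ ψ.symm) (ψ (φ.symm y)) := by
  have hbij := fderiv_transition_bijective hφ hψ hy hyψ g
  have hyt := ψ.map_source hyψ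
  have hess (u v : E) : hessian (g.inChart φ) (F ∘ φ.symm) y u v =
      hessian (g.inChart ψ) (F ∘ ψ.symm) (ψ (φ.symm y)) (fderiv ℝ (ψ ∘ φ.symm) y u)
        (fderiv ℝ (ψ ∘ φ.symm) y v) := by
    have e1 := (hg.isKahlerOn hφ).two_mul_hessian hy (hherm φ hφ y hy) u v
    have e2 := (hg.isKahlerOn hψ).two_mul_hessian hyt (hherm ψ hψ _ hyt)
      (fderiv ℝ (ψ ∘ φ.symm) y u) (fderiv ℝ (ψ ∘ φ.symm) y v)
    rw [← fderiv_fderiv_add_transition hF hφ hψ hy hyψ] at e2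
    linarith
  have hN (u : E) : fderiv ℝ (ψ ∘ φ.symm) y (gradientDeriv (g.inChart φ) (F ∘ φ.symm) y u) =
      gradientDeriv (g.inChart ψ) (F ∘ ψ.symm) (ψ (φ.symm y)) (fderiv ℝ (ψ ∘ φ.symm) y u) := by
    refine (g.isMetricOn_inChart hψ).ext hyt fun w => ?_
    obtain ⟨v, rfl⟩ := hbij.2 w
    rw [← inChart_transition g hφ hψ hy hyψ,
      (g.isMetricOn_inChart hφ).apply_gradientDeriv (contDiffOn_comp_symm hF hφ) hy,
      (g.isMetricOn_inChart hψ).apply_gradientDeriv (contDiffOn_comp_symm hF hψ) hyt, hess]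
  set e : E ≃ₗ[ℝ] E := LinearEquiv.ofBijective (fderiv ℝ (ψ ∘ φ.symm) y : E →ₗ[ℝ] E) hbij
  rw [laplacian, laplacian, ← LinearMap.trace_conj' _ e]
  congr 1
  ext w
  obtain ⟨v, rfl⟩ := hbij.2 w
  have he : e.symm (fderiv ℝ (ψ ∘ φ.symm) y v) = v := e.symm_apply_apply v
  rw [LinearEquiv.conj_apply_apply, he]
  exact hN v

end Invariance

/-! ### The two halves of the theorem -/

section Main

variable {E : Type*} [NormedAddCommGroup E] [NormedSpace ℂ E] [FiniteDimensional ℂ E]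
  {M : Type*} [TopologicalSpace M] [ChartedSpace E M] [IsManifold 𝓘(ℂ, E) ∞ M]
  {g ghat : SmoothRiemannianMetric E M} {f θ : M → ℝ}

open LocalMetric

theorem SmoothRiemannianMetric.IsKillingPotential.hessian_I_I (hf : g.IsKillingPotential f)
    (hg : g.IsKahler) : ∀ φ ∈ atlas E M, ∀ y ∈ φ.target, ∀ v w,
      hessian (g.inChart φ) (f ∘ φ.symm) y (Complex.I • v) (Complex.I • w) =
        hessian (g.inChart φ) (f ∘ φ.symm) y v w :=
  fun φ hφ y hy => (hg.isKahlerOn hφ).hessian_I_I (contDiffOn_comp_symm hf.1 hφ) hy (hf.2 φ hφ y hy)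

/-- The conformal factor is determined by the soliton function. -/
theorem conformal_factor_eq_exp [ConnectedSpace M] (hdim : 3 ≤ Module.finrank ℝ E)
    (hg : g.IsKahler) (hθ : ContMDiff 𝓘(ℝ, E) 𝓘(ℝ, ℝ) ∞ θ) (hθ_ne : ∀ x : M, θ x ≠ 0)
    (hconf : ∀ (x : M) (v w : TangentSpace 𝓘(ℝ, E) x),
      ghat.inner x v w = g.inner x v w / θ x ^ 2)
    (hsol : ghat.IsGradientRicciAlmostSoliton f) (hf : g.IsKillingPotential f)
    {p : M} (hp : f p = 0) {H : ℝ → ℝ} (hH : ContDiff ℝ ∞ H) (hθH : ∀ᶠ x in 𝓝 p, θ x = H (f x))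
    (hH0 : H 0 = 1) (hH1 : deriv H 0 = -2 / ((Module.finrank ℝ E : ℝ) - 2)) (x : M) :
    θ x = Real.exp (-2 * f x / ((Module.finrank ℝ E : ℝ) - 2)) := by
  set m : ℝ := (Module.finrank ℝ E : ℝ) - 2 with hm
  obtain ⟨hfs, c, -, hc⟩ := hsol
  set w : M → ℝ := fun x => θ x - Real.exp (-2 * f x / m) with hw
  have hws : ContMDiff 𝓘(ℝ, E) 𝓘(ℝ, ℝ) ∞ w := by
    have h1 : ContDiff ℝ ∞ fun t : ℝ => Real.exp (-2 * t / m) := by fun_prop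
    exact hθ.sub (h1.contMDiff.comp hfs)
  have heqn : ∀ φ ∈ atlas E M, ∀ y ∈ φ.target, ∀ u v,
      fderiv ℝ (fderiv ℝ (w ∘ φ.symm)) y u v
        - fderiv ℝ (fderiv ℝ (w ∘ φ.symm)) y (Complex.I • u) (Complex.I • v) =
      fderiv ℝ (w ∘ φ.symm) y (solitonCoefficient (g.inChart φ) (f ∘ φ.symm) y u v) :=
    fun φ hφ y hy => (hg.isKahlerOn hφ).conformal_factor_sub_exp (ghat.isMetricOn_inChart hφ) hdim
      (contDiffOn_comp_symm hθ hφ) (contDiffOn_comp_symm hfs hφ) (fun _ _ => hθ_ne _)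
      (fun z _ => SmoothRiemannianMetric.inChart_conformal hθ_ne hconf φ z)
      (c := c ∘ φ.symm) (hc φ hφ) (hf.hessian_I_I hg φ hφ) hy
  -- Unique continuation on the preimage of a ball in a chart, where segments stay in the domain.
  have hprop : ∀ p : M, ∃ V : Set M, IsOpen V ∧ p ∈ V ∧ V ⊆ (chartAt E p).source ∧
      ∀ q ∈ V, w q = 0 → fderiv ℝ (w ∘ (chartAt E p).symm) (chartAt E p q) = 0 →
        fderiv ℝ (fderiv ℝ (w ∘ (chartAt E p).symm)) (chartAt E p q) = 0 → ∀ x ∈ V, w x = 0 := by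
    intro p
    set φ := chartAt E p
    have hφ : φ ∈ atlas E M := chart_mem_atlas E p
    obtain ⟨r, hr, hball⟩ := Metric.isOpen_iff.1 φ.open_target (φ p) (mem_chart_target E p)
    refine ⟨φ.source ∩ φ ⁻¹' Metric.ball (φ p) r, φ.isOpen_inter_preimage Metric.isOpen_ball,
      ⟨mem_chart_source E p, Metric.mem_ball_self hr⟩, Set.inter_subset_left, ?_⟩
    rintro q ⟨hq, hqb⟩ h0 h1 h2 x ⟨hx, hxb⟩
    have := eq_zero_of_jet_eq_zero Metric.isOpen_ball (convex_ball (φ p) r)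
      ((contDiffOn_comp_symm hws hφ).mono hball)
      (((g.isMetricOn_inChart hφ).contDiffOn_solitonCoefficient
        (contDiffOn_comp_symm hfs hφ)).mono hball)
      (fun y hy => heqn φ hφ y (hball hy)) hqb (by simpa [φ.left_inv hq] using h0) h1 h2 hxb
    simpa [φ.left_inv hx] using this
  have hSopen : IsOpen (interior {x | w x = 0}) := isOpen_interior
  -- A limit point has a neighbourhood $V$ as above meeting the open zero set; the 2-jet vanishes at
  -- a common point, so $w=0$ on $V$.
  have hSclosed : IsClosed (interior {x | w x = 0}) := by
    rw [← closure_subset_iff_isClosed]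
    intro p hp
    obtain ⟨V, hVo, hpV, hVs, hV⟩ := hprop p
    obtain ⟨q, hqV, hqS⟩ := mem_closure_iff.1 hp V hVo hpV
    set φ := chartAt E p
    have hev : (w ∘ φ.symm) =ᶠ[𝓝 (φ q)] fun _ => 0 := by
      have hqt := φ.map_source (hVs hqV)
      have ht := φ.continuousAt_symm hqt
      rw [ContinuousAt, φ.left_inv (hVs hqV)] at ht
      exact ht.eventually (mem_interior_iff_mem_nhds.1 hqS)
    have hz := hV q hqV (show q ∈ {x | w x = 0} from interior_subset hqS)
      (by rw [hev.fderiv_eq]; simp) (by rw [hev.fderiv.fderiv_eq]; simp)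
    exact mem_interior.2 ⟨V, hz, hVo, hpV⟩
  have hSne : (interior {x | w x = 0}).Nonempty := by
    obtain ⟨V, hVo, hpV, hVs, hV⟩ := hprop p
    set φ := chartAt E p
    have hφ : φ ∈ atlas E M := chart_mem_atlas E p
    have hpt : φ p ∈ φ.target := mem_chart_target E p
    have hpp : φ.symm (φ p) = p := φ.left_inv (mem_chart_source E p)
    have hfp : (f ∘ φ.symm) (φ p) = 0 := by simp [hpp, hp]
    have hev : (w ∘ φ.symm) =ᶠ[𝓝 (φ p)]
        (fun t => H t - Real.exp (-2 * t / m)) ∘ (f ∘ φ.symm) := by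
      have ht := φ.continuousAt_symm hpt
      rw [ContinuousAt, hpp] at ht
      filter_upwards [ht.eventually hθH] with z hz
      simp [hw, hz]
    -- The prescribed $H'(0)=-2/m$ is exactly the derivative of $e^{-2t/m}$ at $0$.
    have hW1 : deriv (fun t => H t - Real.exp (-2 * t / m)) ((f ∘ φ.symm) (φ p)) = 0 := by
      rw [hfp]
      have h1 : HasDerivAt (fun t : ℝ => -2 * t / m) (-2 * 1 / m) 0 :=
        ((hasDerivAt_id (0 : ℝ)).const_mul (-2)).div_const m
      have h2 := ((hH.differentiable (by simp) 0).hasDerivAt.sub h1.exp).deriv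
      refine h2.trans ?_
      rw [hH1]
      simp
    obtain ⟨j1, j2⟩ := jet_eq_zero_of_eventuallyEq_comp
      (hH.sub (by fun_prop : ContDiff ℝ ∞ fun t : ℝ => Real.exp (-2 * t / m)))
      (contDiffAt_comp_symm hfs hφ hpt) hev hW1 (heqn φ hφ _ hpt)
    have hwp : w p = 0 := by
      have := hθH.self_of_nhds
      simp [hw, this, hp, hH0]
    exact ⟨p, mem_interior.2 ⟨V, hV p hpV hwp j1 j2, hVo, hpV⟩⟩
  have huniv := IsClopen.eq_univ ⟨hSclosed, hSopen⟩ hSne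
  have hx : x ∈ interior {x | w x = 0} := huniv ▸ Set.mem_univ x
  have := interior_subset hx
  exact sub_eq_zero.1 this

/-- `exp (4f / (n - 2)) g` being an almost soliton with Killing potential `f`, the metric `g` is a
gradient Kähler–Ricci soliton. -/
theorem isGradientKahlerRicciSoliton_of_conformal [ConnectedSpace M]
    (hdim : 3 ≤ Module.finrank ℝ E) (hg : g.IsKahler)
    (hθ : ∀ x, θ x = Real.exp (-2 * f x / ((Module.finrank ℝ E : ℝ) - 2)))
    (hconf : ∀ (x : M) (v w : TangentSpace 𝓘(ℝ, E) x),
      ghat.inner x v w = g.inner x v w / θ x ^ 2)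
    (hsol : ghat.IsGradientRicciAlmostSoliton f) (hf : g.IsKillingPotential f) :
    g.IsGradientKahlerRicciSoliton := by
  set m : ℝ := (Module.finrank ℝ E : ℝ) - 2 with hm
  have hm0 : m ≠ 0 := by
    have : (3 : ℝ) ≤ Module.finrank ℝ E := by exact_mod_cast hdim
    rw [hm]; linarith
  obtain ⟨hfs, c, -, hc⟩ := hsol
  have hherm := hf.hessian_I_I hg
  set σ : M → ℝ := fun x => (-2 / m) * f x with hσ
  have hσs : ContMDiff 𝓘(ℝ, E) 𝓘(ℝ, ℝ) ∞ σ := by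
    have h1 : ContDiff ℝ ∞ fun t : ℝ => (-2 / m) * t := by fun_prop
    exact h1.contMDiff.comp hfs
  have hθ_ne (x : M) : θ x ≠ 0 := by rw [hθ]; exact (Real.exp_pos _).ne'
  have hlog (x : M) : Real.log (θ x) = σ x := by
    rw [hθ, Real.log_exp, hσ]
    ring
  have hσhess : ∀ φ ∈ atlas E M, ∀ y ∈ φ.target, ∀ v w,
      hessian (g.inChart φ) (σ ∘ φ.symm) y v w =
        (-2 / m) * hessian (g.inChart φ) (f ∘ φ.symm) y v w := fun φ hφ y hy v w =>
    hessian_const_mul _ (contDiffAt_comp_symm hfs hφ hy) _ v w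
  have hσherm : ∀ φ ∈ atlas E M, ∀ y ∈ φ.target, ∀ v w,
      hessian (g.inChart φ) (σ ∘ φ.symm) y (Complex.I • v) (Complex.I • w) =
        hessian (g.inChart φ) (σ ∘ φ.symm) y v w := by
    intro φ hφ y hy v w
    rw [hσhess φ hφ y hy, hσhess φ hφ y hy, hherm φ hφ y hy]
  -- The coefficient of $g$ as delivered by `ricci_add_of_conformal`, a priori dependent on the
  -- chart through its Laplacian and gradient terms.
  set γ : OpenPartialHomeomorph M E → E → ℝ := fun φ y =>
    c (φ.symm y) * Real.exp (-2 * σ (φ.symm y)) - laplacian (g.inChart φ) (σ ∘ φ.symm) y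
      + m * fderiv ℝ (σ ∘ φ.symm) y (gradient (g.inChart φ) (σ ∘ φ.symm) y)
      + fderiv ℝ (f ∘ φ.symm) y (gradient (g.inChart φ) (σ ∘ φ.symm) y) with hγ
  have hric : ∀ φ ∈ atlas E M, ∀ y ∈ φ.target, ∀ v w,
      ricci (g.inChart φ) y v w - hessian (g.inChart φ) (f ∘ φ.symm) y v w =
        γ φ y * g.inChart φ y v w := by
    intro φ hφ y hy v w
    have e := (g.isMetricOn_inChart hφ).ricci_add_of_conformal (ghat.isMetricOn_inChart hφ)
      (contDiffOn_comp_symm hσs hφ) (fun z _ => by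
        rw [SmoothRiemannianMetric.inChart_conformal hθ_ne hconf, hlog]; rfl)
      (c := c ∘ φ.symm) (hc φ hφ) hy v w
    have d (u : E) : fderiv ℝ (σ ∘ φ.symm) y u = (-2 / m) * fderiv ℝ (f ∘ φ.symm) y u := by
      have h1 : DifferentiableAt ℝ (f ∘ φ.symm) y :=
        (contDiffAt_comp_symm hfs hφ hy).differentiableAt (by simp)
      exact congrArg (fun L : E →L[ℝ] ℝ => L u) (h1.hasFDerivAt.const_mul (-2 / m)).fderiv
    -- For $\sigma=-2f/m$ the coefficient of $df\otimes df$ is $4/m-4/m=0$, and that of $\nabla df$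
    -- is $-2+1=-1$.
    refine Eq.trans ?_ e
    rw [hσhess φ hφ y hy, d, d, ← hm]
    field_simp
    ring
  have hinv : ∀ φ ∈ atlas E M, ∀ y ∈ φ.target, ∀ ψ ∈ atlas E M, φ.symm y ∈ ψ.source →
      γ φ y = γ ψ (ψ (φ.symm y)) := by
    intro φ hφ y hy ψ hψ hyψ
    have hgr := gradient_transition (g := g) hσs hφ hψ hy hyψ
      (fderiv_transition_bijective hφ hψ hy hyψ g).2
    simp only [hγ]
    rw [ψ.left_inv hyψ, laplacian_transition hg hσs hσherm hφ hψ hy hyψ,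
      fderiv_comp_symm_transition hσs hφ hψ hy hyψ, fderiv_comp_symm_transition hfs hφ hψ hy hyψ,
      hgr]
  -- Chart independence glues the local coefficients into one function on $M$, to which the
  -- connectedness argument applies.
  set Γ : M → ℝ := fun x => γ (chartAt E x) (chartAt E x x) with hΓ
  have hΓφ : ∀ φ ∈ atlas E M, ∀ y ∈ φ.target, Γ (φ.symm y) = γ φ y := fun φ hφ y hy =>
    (hinv φ hφ y hy _ (chart_mem_atlas E _) (mem_chart_source E _)).symm
  have hconst := eq_of_forall_hasFDerivAt_zero (E := E) (γ := Γ) fun φ hφ y hy =>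
    (hg.isKahlerOn hφ).hasFDerivAt_zero_of_ricci_sub_hessian hdim (contDiffOn_comp_symm hfs hφ)
      (γ := Γ ∘ φ.symm)
      (fun z hz v w => by rw [hric φ hφ z hz, Function.comp_apply, hΓφ φ hφ z hz]) hy
  obtain ⟨p⟩ := (inferInstance : Nonempty M)
  -- The Hessian enters with coefficient $-1$, so the soliton function is $-f$.
  refine ⟨hg, fun x => (-1) * f x, ?_, Γ p, ?_⟩
  · have h1 : ContDiff ℝ ∞ fun t : ℝ => (-1) * t := by fun_prop
    exact h1.contMDiff.comp hfs
  · intro φ hφ y hy v w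
    have e := hric φ hφ y hy v w
    have h1 : hessian (g.inChart φ) ((fun x => (-1) * f x) ∘ φ.symm) y v w =
        (-1) * hessian (g.inChart φ) (f ∘ φ.symm) y v w :=
      hessian_const_mul _ (contDiffAt_comp_symm hfs hφ hy) _ v w
    rw [h1, hconst p (φ.symm y), hΓφ φ hφ y hy, ← e]
    ring

end Main

end

theorem mainTheorem4
    {E : Type*} [NormedAddCommGroup E] [NormedSpace ℂ E] [FiniteDimensional ℂ E]
    {M : Type*} [TopologicalSpace M] [ChartedSpace E M] [IsManifold 𝓘(ℂ, E) ∞ M]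
    [ConnectedSpace M]
    (n : ℕ) (hn : Module.finrank ℝ E = n) (hn4 : 4 ≤ n)
    (g ghat : SmoothRiemannianMetric E M) (f θ : M → ℝ)
    (hg : g.IsKahler)
    (hθ : ContMDiff 𝓘(ℝ, E) 𝓘(ℝ, ℝ) ∞ θ)
    (hθ_ne : ∀ x : M, θ x ≠ 0)
    -- the metric `ghat` is `g / θ ^ 2`
    (hconf : ∀ (x : M) (v w : TangentSpace 𝓘(ℝ, E) x),
      ghat.inner x v w = g.inner x v w / θ x ^ 2)
    (hsol : ghat.IsGradientRicciAlmostSoliton f)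
    (hf : g.IsKillingPotential f)
    -- `θ` is locally a smooth function of `f` at the points where `df ≠ 0`
    (hloc : ∀ p : M, mfderiv 𝓘(ℝ, E) 𝓘(ℝ, ℝ) f p ≠ 0 →
      ∃ H : ℝ → ℝ, ContDiff ℝ ∞ H ∧ ∀ᶠ x in 𝓝 p, θ x = H (f x))
    -- `θ(0) = 1`
    (h0 : ∀ p : M, f p = 0 → θ p = 1)
    -- `0` is a value of `f`, and `θ'(0) = -2 / (n - 2)`
    (h0' : ∃ p : M, f p = 0 ∧ ∃ H : ℝ → ℝ, ContDiff ℝ ∞ H ∧ (∀ᶠ x in 𝓝 p, θ x = H (f x)) ∧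
      H 0 = 1 ∧ deriv H 0 = -2 / ((n : ℝ) - 2)) :
    (∀ x : M, θ x = Real.exp (-2 * f x / ((n : ℝ) - 2))) ∧
      g.IsGradientKahlerRicciSoliton := by
  obtain ⟨p, hp, H, hH, hθH, hH0, hH1⟩ := h0'
  subst hn
  have hexp := conformal_factor_eq_exp (by omega) hg hθ hθ_ne hconf hsol hf hp hH hθH hH0 hH1
  exact ⟨hexp, isGradientKahlerRicciSoliton_of_conformal (by omega) hg hexp hconf hsol hf⟩
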